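/- **Setting.** Let $\Sigma$ be a finite alphabet. For each $n$ let $X_n=\binom{[n]}{2}$ (edge-colored ordered graphs on $n$ vertices) or, alternatively, $X_n=[n]\times[n]$ ($n\times n$ images). A *property* $\mathcal P$ is an arbitrary collection of functions $f:X_n\to\Sigma$, $n\ge 0$. The relative Hamming distance of $f,g:X_n\to\Sigma$ is the fraction of entries of $X_n$ on which they differ; $f$ is *$\epsilon$-close* to $\mathcal P$ if it is at distance at most $\epsilon$ from some $g:X_n\to\Sigma$ in $\mathcal P$, and *$\epsilon$-far* otherwise. *Earthmover resilience.* A basic move swaps two consecutive vertices of an ordered graph, or two consecutive rows or two consecutive columns of an image. The earthmover distance $d_e(f,f')$ is the least number of basic moves turning $f$ into $f'$ ($+\infty$ if impossible), divided by $\binom n2$ for graphs and by $\binom{2n}{2}$ for images (for $n\le 1$ the only finite value is $0$). For $\delta:(0,1)\to(0,1)$, $\mathcal P$ is *$\delta$-earthmover resilient* if for all $\epsilon\in(0,1)$, $f\in\mathcal P$ and $f'$ with $d_e(f,f')\le\delta(\epsilon)$, $f'$ is $\epsilon$-close to $\mathcal P$; it is *earthmover resilient* if this holds for some $\delta:(0,1)\to(0,1)$.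 *Tests.* All tests know $n$. A *$q$-query (non-adaptive) test* draws a random set of at most $q$ entries of $X_n$, reads $f$ on it, and accepts with a probability depending on the set and on the values read. $\mathcal P$ is *$\eta$-tolerantly testable* with $q(\epsilon)$ queries, where $\eta:(0,1)\to(0,1)$, if for all $\epsilon\in(0,1)$ and all $n$ there is such a test with at most $q(\epsilon)$ queries that accepts every $f$ that is $\eta(\epsilon)$-close to $\mathcal P$ with probability at least $2/3$ and rejects every $f$ that is $\epsilon$-far from $\mathcal P$ with probability at least $2/3$. $\mathcal P$ is *tolerantly testable* if it is $\eta$-tolerantly testable with $q(\epsilon)$ queries for some $q$ and some $\eta$ with $0<\eta(\epsilon)<\epsilon$. A *canonical test with $q$ queries* draws uniformly at random $\min(q,n)$ vertices (for images: $\min(q,n)$ rows and, independently, $\min(q,n)$ columns) and accepts with a probability that depends only on the induced ordered subgraph (the submatrix) seen. $\mathcal P$ is *canonically testable* with $q'(\epsilon)$ queries if for all $\epsilon\in(0,1)$ and all $n$ there is a canonical test with $q'(\epsilon)$ queries that accepts every $f\in\mathcal P$, and rejects every $f$ that is $\epsilon$-far from $\mathcal P$, each with probability at least $2/3$. A nonnegative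 function $g$ on $(0,1)$ is *polynomial in $1/\epsilon$* if $g(\epsilon)\le C\epsilon^{-k}$ on $(0,1)$ for some constants $C,k$. **Theorem.** Let $\mathcal P$ be a property of edge-colored ordered graphs or of images. 0. $\mathcal P$ is earthmover resilient and tolerantly testable if and only if it is canonically testable. 1. Let $\delta,\eta:(0,1)\to(0,1)$ with $\eta(\epsilon)<\epsilon$ for all $\epsilon$. If $\mathcal P$ is $\delta$-earthmover resilient and $\eta$-tolerantly testable with $q(\epsilon)$ queries, then $\mathcal P$ is canonically testable. If moreover $q$, $1/\eta$ and $1/\delta$ are polynomial in $1/\epsilon$, then $\mathcal P$ is canonically testable with $q'(\epsilon)$ queries for some $q'$ that is polynomial in $1/\epsilon$. 2. If $\mathcal P$ is canonically testable with $q'(\epsilon)$ queries, put $\delta'(\epsilon)=\dfrac{1}{20\max\{1,\binom{q'(\epsilon)}{2}\}}\in(0,1)$. Then $\mathcal P$ is $\delta'$-earthmover resilient, and it is $\delta'$-tolerantly testable (hence also $\min\{\delta'(\epsilon),\epsilon/2\}$-tolerantly testable) with a number of queries that depends only on $\epsilon$. If moreover $q'$ is polynomial in $1/\epsilon$, then so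 are $1/\delta'(\epsilon)$ and $1/\min\{\delta'(\epsilon),\epsilon/2\}$. -/

import Mathlib

/-- The two kinds of ordered two-dimensional structures:
edge-colored ordered graphs `f : ([n] choose 2) → α` and images `f : [n] × [n] → α`. -/
inductive OrdKind where
  | graph
  | image

namespace OrdKind

/-- The unordered pairs of distinct elements of `[n]`. -/
abbrev Pair (n : ℕ) : Type := {s : Finset (Fin n) // s.card = 2}

/-- The image of a pair under an injective map. -/
def Pair.map {m n : ℕ} (φ : Fin m ↪ Fin n) (e : Pair m) : Pair n :=
  ⟨e.1.map φ, by rw [Finset.card_map]; exact e.2⟩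

/-- The entries of a structure of size `n`: the pairs of vertices of an ordered graph on `n`
vertices, the pixels (row, column) of an `n × n` image. -/
def Entry : OrdKind → ℕ → Type
  | graph, n => Pair n
  | image, n => Fin n × Fin n

instance instFintypeEntry : (K : OrdKind) → (n : ℕ) → Fintype (Entry K n)
  | graph, n => inferInstanceAs (Fintype (Pair n))
  | image, n => inferInstanceAs (Fintype (Fin n × Fin n))

instance instDecidableEqEntry : (K : OrdKind) → (n : ℕ) → DecidableEq (Entry K n)
  | graph, n => inferInstanceAs (DecidableEq (Pair n))
  | image, n => inferInstanceAs (DecidableEq (Fin n × Fin n))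

/-- A structure of kind `K` and size `n` with colors in `α`. -/
abbrev Obj (K : OrdKind) (α : Type*) (n : ℕ) : Type _ := Entry K n → α

/-- A property is an arbitrary collection of structures of each size. -/
abbrev Property (K : OrdKind) (α : Type*) : Type _ := (n : ℕ) → Set (Obj K α n)

section Distances

variable {K : OrdKind} {α : Type*} {n : ℕ}

/-- Relative Hamming distance: the fraction of entries on which `f` and `g` differ. -/
noncomputable def relHamming [DecidableEq α] (f g : Obj K α n) : ℝ :=
  (hammingDist f g : ℝ) / (Fintype.card (Entry K n) : ℝ)

/-- `f` is `ε`-close to the set `S`: its distance to some member of `S` is at most `ε`.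
Every `f` is `ε`-far from the empty set. -/
def CloseTo [DecidableEq α] (S : Set (Obj K α n)) (ε : ℝ) (f : Obj K α n) : Prop :=
  ∃ g ∈ S, relHamming f g ≤ ε

/-- `f'` results from `f` by one basic move: swapping two consecutive vertices of an ordered
graph; swapping two consecutive rows, or two consecutive columns, of an image. -/
def BasicMove : (K : OrdKind) → Obj K α n → Obj K α n → Prop
  | graph, f, f' => ∃ i j : Fin n, (j : ℕ) = (i : ℕ) + 1 ∧
      f' = fun e : Pair n => f (e.map (Equiv.swap i j).toEmbedding)
  | image, f, f' => ∃ i j : Fin n, (j : ℕ) = (i : ℕ) + 1 ∧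
      ((f' = fun p : Fin n × Fin n => f (Equiv.swap i j p.1, p.2)) ∨
       (f' = fun p : Fin n × Fin n => f (p.1, Equiv.swap i j p.2)))

/-- `MovesIn m f f'`: some sequence of exactly `m` basic moves turns `f` into `f'`. -/
inductive MovesIn : ℕ → Obj K α n → Obj K α n → Prop where
  | zero (f : Obj K α n) : MovesIn 0 f f
  | succ {m : ℕ} {f g h : Obj K α n} : MovesIn m f g → BasicMove K g h → MovesIn (m + 1) f h

/-- Absolute earthmover distance: the least number of basic moves (`⊤` if there is none). -/
noncomputable def absEarthmover (f f' : Obj K α n) : ℕ∞ :=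
  sInf {d : ℕ∞ | ∃ m : ℕ, d = (m : ℕ∞) ∧ MovesIn m f f'}

/-- The number of base elements: `n` vertices, respectively `n` rows and `n` columns. -/
def numBase : OrdKind → ℕ → ℕ
  | graph, n => n
  | image, n => 2 * n

/-- Earthmover distance, normalized by the number of pairs of base elements. -/
noncomputable def earthmover (f f' : Obj K α n) : ENNReal :=
  ((absEarthmover f f' : ℕ∞) : ENNReal) / (((numBase K n).choose 2 : ℕ) : ENNReal)

end Distances

/-- `δ`-earthmover resilience. -/
def ResilientWith {K : OrdKind} {α : Type*} [DecidableEq α]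
    (P : Property K α) (δ : ℝ → ℝ) : Prop :=
  ∀ ε ∈ Set.Ioo (0 : ℝ) 1, ∀ (n : ℕ) (f f' : Obj K α n),
    f ∈ P n → earthmover f f' ≤ ENNReal.ofReal (δ ε) → CloseTo (P n) ε f'

/-- Earthmover resilience: `δ`-earthmover resilience for some `δ : (0,1) → (0,1)`. -/
def Resilient {K : OrdKind} {α : Type*} [DecidableEq α] (P : Property K α) : Prop :=
  ∃ δ : ℝ → ℝ, (∀ ε ∈ Set.Ioo (0 : ℝ) 1, δ ε ∈ Set.Ioo (0 : ℝ) 1) ∧ ResilientWith P δ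

/-- A randomized non-adaptive algorithm reading functions `E → α` in at most `q` places: it draws a
set of at most `q` entries and, given that set and the values on it, accepts with probability
`decision`. -/
structure QueryAlgorithm (E : Type*) (α : Type*) (q : ℕ) where
  queries : PMF (Finset E)
  card_le : ∀ S ∈ queries.support, S.card ≤ q
  decision : (S : Finset E) → (S → α) → Set.Icc (0 : ℝ) 1

/-- The probability that the algorithm accepts `f`. -/
noncomputable def QueryAlgorithm.acceptProb {E α : Type*} [Fintype E] {q : ℕ}
    (T : QueryAlgorithm E α q) (f : E → α) : ℝ :=
  ∑ S : Finset E, (T.queries S).toReal * (T.decision S (fun x => f x.1) : ℝ)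

/-- An algorithm for inputs of size `n`, given by its acceptance probabilities, accepts every `f`
that is `η`-close to `S`, and rejects every `f` that is `ε`-far from `S`, with probability at least
`2/3`. -/
def Distinguishes {K : OrdKind} {α : Type*} [DecidableEq α] {n : ℕ} (S : Set (Obj K α n))
    (ε η : ℝ) (acc : Obj K α n → ℝ) : Prop :=
  (∀ f, CloseTo S η f → 2 / 3 ≤ acc f) ∧ (∀ f, ¬ CloseTo S ε f → 2 / 3 ≤ 1 - acc f)

/-- For every `ε ∈ (0,1)` and every (known) size `n` there is a non-adaptive `(ε, η(ε))`-tolerant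
test reading at most `q(ε)` entries. -/
def TolerantlyTestableWith {K : OrdKind} {α : Type*} [DecidableEq α]
    (P : Property K α) (η : ℝ → ℝ) (q : ℝ → ℕ) : Prop :=
  ∀ ε ∈ Set.Ioo (0 : ℝ) 1, ∀ n : ℕ, ∃ T : QueryAlgorithm (Entry K n) α (q ε),
    Distinguishes (P n) ε (η ε) T.acceptProb

/-- Tolerant testability: constant-query `(ε, η(ε))`-tolerant tests for some `η` with
`0 < η(ε) < ε`. -/
def TolerantlyTestable {K : OrdKind} {α : Type*} [DecidableEq α] (P : Property K α) : Prop :=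
  ∃ (η : ℝ → ℝ) (q : ℝ → ℕ), (∀ ε ∈ Set.Ioo (0 : ℝ) 1, 0 < η ε ∧ η ε < ε) ∧
    TolerantlyTestableWith P η q

/-- The possible samples of a canonical algorithm: an increasing sequence of `m` vertices,
respectively increasing sequences of `m` rows and of `m` columns. -/
def Sample : OrdKind → ℕ → ℕ → Type
  | graph, m, n => Fin m ↪o Fin n
  | image, m, n => (Fin m ↪o Fin n) × (Fin m ↪o Fin n)

instance instFiniteSample : (K : OrdKind) → (m n : ℕ) → Finite (Sample K m n)
  | graph, m, n => inferInstanceAs (Finite (Fin m ↪o Fin n))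
  | image, m, n => inferInstanceAs (Finite ((Fin m ↪o Fin n) × (Fin m ↪o Fin n)))

noncomputable instance instFintypeSample (K : OrdKind) (m n : ℕ) : Fintype (Sample K m n) :=
  Fintype.ofFinite _

/-- The induced ordered subgraph, respectively the submatrix, of `f` on a sample. -/
def restrict {α : Type*} {m n : ℕ} : {K : OrdKind} → Obj K α n → Sample K m n → Obj K α m
  | graph, f, φ => fun e : Pair m => f (e.map (RelEmbedding.toEmbedding φ))
  | image, f, φ => fun p : Fin m × Fin m => f (φ.1 p.1, φ.2 p.2)

/-- A canonical algorithm for inputs of size `n` draws uniformly at random `min q n` vertices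
(respectively `min q n` rows and `min q n` columns), and accepts with a probability that depends
only on the induced ordered subgraph (submatrix) that it sees. -/
structure CanonicalAlgorithm (K : OrdKind) (α : Type*) (q n : ℕ) where
  decision : Obj K α (min q n) → Set.Icc (0 : ℝ) 1

/-- The probability that a canonical algorithm accepts `f`. -/
noncomputable def CanonicalAlgorithm.acceptProb {K : OrdKind} {α : Type*} {q n : ℕ}
    (T : CanonicalAlgorithm K α q n) (f : Obj K α n) : ℝ :=
  (∑ s : Sample K (min q n) n, (T.decision (restrict f s) : ℝ)) /
    (Fintype.card (Sample K (min q n) n) : ℝ)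

/-- For every `ε ∈ (0,1)` and every (known) size `n` there is a canonical `ε`-test drawing `q(ε)`
vertices (respectively `q(ε)` rows and `q(ε)` columns). -/
def CanonicallyTestableWith {K : OrdKind} {α : Type*} [DecidableEq α]
    (P : Property K α) (q : ℝ → ℕ) : Prop :=
  ∀ ε ∈ Set.Ioo (0 : ℝ) 1, ∀ n : ℕ, ∃ T : CanonicalAlgorithm K α (q ε) n,
    (∀ f ∈ P n, 2 / 3 ≤ T.acceptProb f) ∧
    (∀ f, ¬ CloseTo (P n) ε f → 2 / 3 ≤ 1 - T.acceptProb f)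

/-- Canonical testability. -/
def CanonicallyTestable {K : OrdKind} {α : Type*} [DecidableEq α] (P : Property K α) : Prop :=
  ∃ q : ℝ → ℕ, CanonicallyTestableWith P q

/-- `g` is polynomially bounded in `1/ε` on `(0,1)`. -/
def PolyBounded (g : ℝ → ℝ) : Prop :=
  ∃ (C : ℝ) (k : ℕ), ∀ ε ∈ Set.Ioo (0 : ℝ) 1, g ε ≤ C * (1 / ε) ^ k

/-- `1 / (20 · (q(ε) choose 2))`, the binomial coefficient being replaced by `1` if `q(ε) ≤ 1`. -/
noncomputable def canonicalDelta (q : ℝ → ℕ) (ε : ℝ) : ℝ :=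
  1 / (20 * (max 1 ((q ε).choose 2) : ℕ))

end OrdKind

/-! From canonical tests. The acceptance probability of a canonical test is a Lipschitz function of
the input. Changing a fraction `d` of the entries matters only if the sample shows one of them, and
the expected number shown is `d` times the number of entries of a sample
(`CanonicalAlgorithm.abs_acceptProb_sub_le_relHamming`). Swapping two consecutive elements permutes
the samples, except those containing both, which have probability `(m choose 2) / (n choose 2)` for
samples of size `m` (`CanonicalAlgorithm.abs_acceptProb_sub_le_of_basicMove`). As 2/3 and 1/3 are a
constant apart, few moves cannot lead from a member to a far structure, which is resilience; and
structures near a member keep an acceptance probability above that of far ones, a gap that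
repetition widens (`QueryAlgorithm.exists_amplification`), which is tolerance.

To canonical tests. The tolerant test is run on a rearrangement `f ∘ π` of the input, where the
random `π` must meet two opposite demands: it moves elements so little that resilience keeps `f ∘ π`
about as close to the property as `f`, yet its values on the queried vertices can be read off a
uniform sample. Split `[n]` into residue classes with about `s ^ 2` elements each, draw a uniform
permutation `σ`, and let `π` be `σ` sorted inside each class (`classPerm`). A class is evenly spread
over `[n]`, and its random image is evenly spread up to a relative error of order `1 / s`, so the
increasing matching of the two moves elements by `O(n / s)` on average (`displacement_classPerm_le`,
`exists_classes`); bubble sort turns displacement into basic moves (`exists_movesIn_permute`). On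
the other hand, `π` on the queried vertices depends only on `σ` on their classes, a bounded number
of vertices, and a uniform permutation maps these to a uniform sample read in an independent uniform
order (`exists_decision_of_classPerm`). An image uses one independent `π` for rows and one for
columns. All bounds are polynomial. -/

namespace OrdKind

open scoped BigOperators

/-! ### Axes and pulling back along injections -/

section Axes

/-- The coordinates of a structure that can be permuted independently: the vertices of a graph,
the rows and the columns of an image. -/
def Axis : OrdKind → Type
  | graph => Unit
  | image => Bool

instance instFintypeAxis : (K : OrdKind) → Fintype (Axis K)
  | graph => inferInstanceAs (Fintype Unit)
  | image => inferInstanceAs (Fintype Bool)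

instance instDecidableEqAxis : (K : OrdKind) → DecidableEq (Axis K)
  | graph => inferInstanceAs (DecidableEq Unit)
  | image => inferInstanceAs (DecidableEq Bool)

/-- The entry that results from renaming the base elements along every axis. -/
def pull {m n : ℕ} : {K : OrdKind} → (Axis K → Fin m ↪ Fin n) → Entry K m → Entry K n
  | graph, φ, e => Pair.map (φ ()) e
  | image, φ, p => (φ false p.1, φ true p.2)

/-- The base elements, on any axis, that an entry involves. -/
def verts {n : ℕ} : {K : OrdKind} → Entry K n → Finset (Fin n)
  | graph, e => e.1
  | image, p => {p.1, p.2}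

variable {K : OrdKind} {m n k : ℕ}

lemma card_verts_le (e : Entry K n) : (verts e).card ≤ 2 := by
  cases K
  · exact e.2.le
  · exact Finset.card_le_two

lemma pull_pull (ψ : Axis K → Fin n ↪ Fin k) (φ : Axis K → Fin m ↪ Fin n) (e : Entry K m) :
    pull ψ (pull φ e) = pull (fun i => (φ i).trans (ψ i)) e := by
  cases K
  · exact Subtype.ext (Finset.map_map _ _ _)
  · rfl

lemma pull_refl (e : Entry K n) : pull (fun _ => Function.Embedding.refl (Fin n)) e = e := by
  cases K
  · exact Subtype.ext Finset.map_refl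
  · rfl

lemma pull_congr {φ ψ : Axis K → Fin m ↪ Fin n} {e : Entry K m}
    (h : ∀ i, ∀ a ∈ verts e, φ i a = ψ i a) : pull φ e = pull ψ e := by
  cases K
  · refine Subtype.ext ?_
    change e.1.map _ = e.1.map _
    rw [Finset.map_eq_image, Finset.map_eq_image]
    exact Finset.image_congr fun a ha => h () a ha
  · exact Prod.ext (h false _ (by simp [verts])) (h true _ (by simp [verts]))

lemma verts_pull (w : Fin m ↪ Fin n) (e : Entry K m) :
    verts (pull (fun _ => w) e) = (verts e).map w := by
  cases K
  · rfl
  · change ({w e.1, w e.2} : Finset (Fin n)) = Finset.map w {e.1, e.2}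
    simp

lemma exists_pull_eq (w : Fin m ↪ Fin n) (e : Entry K n) (h : ∀ a ∈ verts e, a ∈ Set.range w) :
    ∃ e' : Entry K m, pull (fun _ => w) e' = e := by
  cases K
  · have hs : e.1 ⊆ Finset.univ.map w := by
      intro a ha
      obtain ⟨b, rfl⟩ := h a ha
      simp
    obtain ⟨u, -, hu⟩ := Finset.subset_map_iff.1 hs
    refine ⟨⟨u, ?_⟩, Subtype.ext hu.symm⟩
    have := e.2
    rwa [hu, Finset.card_map] at this
  · obtain ⟨a, ha⟩ := h e.1 (by simp [verts])
    obtain ⟨b, hb⟩ := h e.2 (by simp [verts])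
    exact ⟨(a, b), Prod.ext ha hb⟩

/-- Renaming the base elements of an entry by one permutation for each axis. -/
def permute (σ : Axis K → Equiv.Perm (Fin n)) : Entry K n → Entry K n :=
  pull fun i => (σ i).toEmbedding

lemma permute_mul (σ τ : Axis K → Equiv.Perm (Fin n)) (e : Entry K n) :
    permute (σ * τ) e = permute σ (permute τ e) :=
  (pull_pull (fun i => (σ i).toEmbedding) (fun i => (τ i).toEmbedding) e).symm

lemma permute_one (e : Entry K n) : permute (1 : Axis K → Equiv.Perm (Fin n)) e = e :=
  pull_refl e

/-- The bijection of the entries induced by permutations of the base elements. -/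
def permuteEquiv (σ : Axis K → Equiv.Perm (Fin n)) : Equiv.Perm (Entry K n) where
  toFun := permute σ
  invFun := permute σ⁻¹
  left_inv e := by rw [← permute_mul, inv_mul_cancel, permute_one]
  right_inv e := by rw [← permute_mul, mul_inv_cancel, permute_one]

lemma exists_perm_trans (φ ψ : Fin m ↪ Fin n) :
    ∃ ρ : Equiv.Perm (Fin n), φ.trans ρ.toEmbedding = ψ := by
  classical
  let e : {x // x ∈ Set.range φ} ≃ {x // x ∈ Set.range ψ} :=
    (Equiv.ofInjective φ φ.injective).symm.trans (Equiv.ofInjective ψ ψ.injective)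
  refine ⟨e.extendSubtype, ?_⟩
  ext a : 1
  change e.extendSubtype (φ a) = ψ a
  rw [Equiv.extendSubtype_apply_of_mem e _ ⟨a, rfl⟩]
  simp [e, Equiv.ofInjective_symm_apply]

lemma exists_permute_eq (e e' : Entry K n) :
    ∃ σ : Axis K → Equiv.Perm (Fin n), permute σ e = e' := by
  cases K
  · let φ : Fin 2 ↪ Fin n := (e.1.orderEmbOfFin e.2).toEmbedding
    let ψ : Fin 2 ↪ Fin n := (e'.1.orderEmbOfFin e'.2).toEmbedding
    obtain ⟨ρ, hρ⟩ := exists_perm_trans φ ψ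
    refine ⟨fun _ => ρ, Subtype.ext ?_⟩
    change e.1.map ρ.toEmbedding = e'.1
    have h1 : Finset.univ.map φ = e.1 := by simp [φ]
    have h2 : Finset.univ.map ψ = e'.1 := by simp [ψ]
    rw [← h1, ← h2, Finset.map_map, hρ]
  · exact ⟨fun i => cond i (Equiv.swap e.2 e'.2) (Equiv.swap e.1 e'.1),
      Prod.ext (Equiv.swap_apply_left _ _) (Equiv.swap_apply_left _ _)⟩

/-- A sample consists of one increasing sequence for each axis. -/
def sampleEquiv : (K : OrdKind) → (m n : ℕ) → Sample K m n ≃ (Axis K → Fin m ↪o Fin n)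
  | graph, _, _ => (Equiv.funUnique Unit _).symm
  | image, _, _ => (Equiv.boolArrowEquivProd _).symm

/-- The entry of the large structure that a sample shows as a given entry. -/
def samplePull (s : Axis K → Fin m ↪o Fin n) : Entry K m → Entry K n :=
  pull fun i => (s i).toEmbedding

lemma restrict_eq {α : Type*} (f : Obj K α n) (s : Sample K m n) :
    restrict f s = fun e => f (samplePull (sampleEquiv K m n s) e) := by
  cases K <;> rfl

lemma permute_graph_mulSingle (τ : Equiv.Perm (Fin n)) (e : Pair n) :
    permute (K := graph) (Pi.mulSingle (M := fun _ : Axis graph => Equiv.Perm (Fin n)) () τ) e =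
      e.map τ.toEmbedding := by
  have h : Pi.mulSingle (M := fun _ : Axis graph => Equiv.Perm (Fin n)) () τ = fun _ => τ :=
    funext fun _ => Pi.mulSingle_eq_same (M := fun _ : Axis graph => Equiv.Perm (Fin n)) () τ
  rw [h]
  rfl

lemma basicMove_iff {α : Type*} (f f' : Obj K α n) :
    BasicMove K f f' ↔ ∃ (x : Axis K) (i j : Fin n), (j : ℕ) = (i : ℕ) + 1 ∧
      f' = fun e => f (permute (Pi.mulSingle x (Equiv.swap i j)) e) := by
  cases K
  · constructor
    · rintro ⟨i, j, h, rfl⟩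
      exact ⟨(), i, j, h, funext fun e => congrArg f (permute_graph_mulSingle _ e).symm⟩
    · rintro ⟨⟨⟩, i, j, h, rfl⟩
      exact ⟨i, j, h, funext fun e => congrArg f (permute_graph_mulSingle _ e)⟩
  · constructor
    · rintro ⟨i, j, h, rfl | rfl⟩
      · exact ⟨false, i, j, h, rfl⟩
      · exact ⟨true, i, j, h, rfl⟩
    · rintro ⟨x, i, j, h, rfl⟩
      cases x
      · exact ⟨i, j, h, Or.inl rfl⟩
      · exact ⟨i, j, h, Or.inr rfl⟩

end Axes

/-! ### Inversions, displacement and basic moves -/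

section Moves

/-- The inversions of a permutation. -/
def inversions {n : ℕ} (π : Equiv.Perm (Fin n)) : Finset (Fin n × Fin n) :=
  Finset.univ.filter fun p => p.1 < p.2 ∧ π p.2 < π p.1

/-- The total displacement `∑ |π a - a|` of a permutation. -/
def displacement {n : ℕ} (π : Equiv.Perm (Fin n)) : ℕ :=
  ∑ a, (((π a : ℕ) - a) + ((a : ℕ) - π a))

variable {K : OrdKind} {n : ℕ}

lemma mem_inversions {π : Equiv.Perm (Fin n)} {p : Fin n × Fin n} :
    p ∈ inversions π ↔ p.1 < p.2 ∧ π p.2 < π p.1 := by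
  simp [inversions]

lemma displacement_inv (π : Equiv.Perm (Fin n)) : displacement π⁻¹ = displacement π := by
  unfold displacement
  rw [← Equiv.sum_comp π]
  exact Finset.sum_congr rfl fun a _ => by simp [add_comm]

lemma displacement_one : displacement (1 : Equiv.Perm (Fin n)) = 0 := by
  simp [displacement]

/-- Split the inversions `(a, b)` by whether `b ≤ π a`. If so, `b` lies in `(a, π a]`, which leaves
`π a - a` choices for each `a`. Otherwise `π a` lies in `(π b, b)`, which leaves fewer than `b - π
b` choices for each `b` with `π b < b`, and none for the others. -/
lemma card_inversions_le (π : Equiv.Perm (Fin n)) : (inversions π).card ≤ displacement π := by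
  classical
  let A : Finset (Fin n × Fin n) := Finset.univ.filter fun p => p.1 < p.2 ∧ p.2 ≤ π p.1
  let B : Finset (Fin n × Fin n) := Finset.univ.filter fun p => π p.2 < π p.1 ∧ π p.1 < p.2
  have hsub : inversions π ⊆ A ∪ B := by
    intro p hp
    rw [mem_inversions] at hp
    simp only [A, B, Finset.mem_union, Finset.mem_filter, Finset.mem_univ, true_and]
    rcases le_or_gt p.2 (π p.1) with h | h
    · exact Or.inl ⟨hp.1, h⟩
    · exact Or.inr ⟨hp.2, h⟩
  have hA : A.card ≤ ∑ a : Fin n, ((π a : ℕ) - a) := by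
    have : A ⊆ (Finset.univ : Finset (Fin n)).biUnion
        fun a => (Finset.Ioc a (π a)).map ⟨fun b => (a, b), fun _ _ h => (Prod.ext_iff.1 h).2⟩ := by
      intro p hp
      simp only [A, Finset.mem_filter, Finset.mem_univ, true_and] at hp
      simp only [Finset.mem_biUnion, Finset.mem_univ, true_and, Finset.mem_map,
        Finset.mem_Ioc]
      exact ⟨p.1, p.2, hp, rfl⟩
    refine (Finset.card_le_card this).trans (Finset.card_biUnion_le.trans ?_)
    exact Finset.sum_le_sum fun a _ => by simp
  have hB : B.card ≤ ∑ b : Fin n, ((b : ℕ) - π b) := by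
    have : B ⊆ (Finset.univ : Finset (Fin n)).biUnion
        fun b => (Finset.Ioo (π b) b).image fun c => (π.symm c, b) := by
      intro p hp
      simp only [B, Finset.mem_filter, Finset.mem_univ, true_and] at hp
      simp only [Finset.mem_biUnion, Finset.mem_univ, true_and, Finset.mem_image,
        Finset.mem_Ioo]
      exact ⟨p.2, π p.1, hp, by simp⟩
    refine (Finset.card_le_card this).trans (Finset.card_biUnion_le.trans ?_)
    exact Finset.sum_le_sum fun b _ => Finset.card_image_le.trans (by simp)
  calc (inversions π).card ≤ (A ∪ B).card := Finset.card_le_card hsub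
    _ ≤ A.card + B.card := Finset.card_union_le _ _
    _ ≤ _ := add_le_add hA hB
    _ = displacement π := Finset.sum_add_distrib.symm

lemma exists_adjacent_descent (π : Equiv.Perm (Fin n)) (h : π ≠ 1) :
    ∃ i j : Fin n, (j : ℕ) = i + 1 ∧ π j < π i := by
  by_contra! hcon
  apply h
  have : Monotone π := by
    cases n with
    | zero => exact fun a => a.elim0
    | succ n => exact Fin.monotone_iff_le_succ.2 fun i => hcon _ _ (by simp)
  exact (Equiv.Perm.monotone_iff π).1 this

/-- One step of bubble sort: applying the swap to both coordinates embeds the new inversions into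
the old ones and misses `(i, j)`. -/
lemma card_inversions_mul_swap_lt (π : Equiv.Perm (Fin n)) {i j : Fin n} (hij : (j : ℕ) = i + 1)
    (h : π j < π i) : (inversions (π * Equiv.swap i j)).card < (inversions π).card := by
  classical
  have hmem : (i, j) ∈ inversions π := by
    rw [mem_inversions]
    exact ⟨Fin.lt_def.2 (by dsimp only; omega), h⟩
  rw [← Finset.card_erase_add_one hmem, Nat.lt_succ_iff]
  refine Finset.card_le_card_of_injOn
    (fun p => (Equiv.swap i j p.1, Equiv.swap i j p.2)) ?_ ?_
  · rintro ⟨a, b⟩ hp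
    obtain ⟨hab, hlt⟩ := mem_inversions.1 hp
    simp only [Equiv.Perm.mul_apply] at hab hlt
    simp only [Finset.mem_coe, Finset.mem_erase, mem_inversions, ne_eq, Prod.mk.injEq]
    have hne : ¬ (a = i ∧ b = j) := by
      rintro ⟨rfl, rfl⟩
      rw [Equiv.swap_apply_left, Equiv.swap_apply_right] at hlt
      exact lt_asymm h hlt
    refine ⟨?_, ?_, hlt⟩
    rotate_left
    · rw [Equiv.swap_apply_def, Equiv.swap_apply_def]
      simp only [Fin.ext_iff] at hne
      split_ifs <;> simp only [Fin.lt_def, Fin.ext_iff] at * <;> omega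
    · rintro ⟨h1, h2⟩
      have h1' : a = j := (Equiv.swap_apply_eq_iff.1 h1).trans (Equiv.swap_apply_left i j)
      have h2' : b = i := (Equiv.swap_apply_eq_iff.1 h2).trans (Equiv.swap_apply_right i j)
      rw [h1', h2', Fin.lt_def] at hab
      omega
  · rintro ⟨a, b⟩ _ ⟨c, d⟩ _ hp
    simpa using hp

/-- Bubble sort on one axis at a time: removing an adjacent descent lowers the total number of
inversions, and a final basic move puts it back. -/
lemma exists_movesIn_permute {α : Type*} (f : Obj K α n) (σ : Axis K → Equiv.Perm (Fin n)) :
    ∃ k ≤ ∑ x, displacement (σ x), MovesIn k f (fun e => f (permute σ e)) := by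
  suffices h : ∀ N (σ : Axis K → Equiv.Perm (Fin n)), ∑ x, (inversions (σ x)).card = N →
      ∃ k ≤ N, MovesIn k f (fun e => f (permute σ e)) by
    obtain ⟨k, hk, hm⟩ := h _ σ rfl
    exact ⟨k, hk.trans (Finset.sum_le_sum fun x _ => card_inversions_le _), hm⟩
  intro N
  induction N using Nat.strong_induction_on with
  | _ N ih =>
    intro σ hN
    by_cases hσ : σ = 1
    · subst hσ
      refine ⟨0, Nat.zero_le _, ?_⟩
      simp only [permute_one]
      exact MovesIn.zero f
    · obtain ⟨x, hx⟩ : ∃ x, σ x ≠ 1 := by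
        by_contra! hcon
        exact hσ (funext hcon)
      obtain ⟨i, j, hij, hlt⟩ := exists_adjacent_descent (σ x) hx
      let t : Axis K → Equiv.Perm (Fin n) := Pi.mulSingle x (Equiv.swap i j)
      have htt : t * t = 1 := by
        simp only [t, ← Pi.mulSingle_mul, Equiv.swap_mul_self, Pi.mulSingle_one]
      have hlt' : ∑ y, (inversions ((σ * t) y)).card < N := by
        rw [← hN]
        refine Finset.sum_lt_sum (fun y _ => ?_) ⟨x, Finset.mem_univ _, ?_⟩
        · by_cases hy : y = x
          · subst hy
            simpa [t] using (card_inversions_mul_swap_lt _ hij hlt).le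
          · simp [t, Pi.mulSingle_eq_of_ne hy]
        · simpa [t] using card_inversions_mul_swap_lt _ hij hlt
      obtain ⟨k, hk, hm⟩ := ih _ hlt' (σ * t) rfl
      refine ⟨k + 1, by omega, hm.succ ((basicMove_iff _ _).2 ⟨x, i, j, hij, ?_⟩)⟩
      funext e
      rw [← permute_mul, show σ * t * Pi.mulSingle x (Equiv.swap i j) = σ from by
        rw [mul_assoc]; exact (congrArg (σ * ·) htt).trans (mul_one σ)]

lemma earthmover_le_of_movesIn {α : Type*} {f f' : Obj K α n} {k : ℕ} {δ : ℝ}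
    (h : MovesIn k f f') (hk : (k : ℝ) ≤ δ * ((numBase K n).choose 2 : ℕ)) (hδ : 0 ≤ δ) :
    earthmover f f' ≤ ENNReal.ofReal δ := by
  refine ENNReal.div_le_of_le_mul ?_
  have h1 : absEarthmover f f' ≤ (k : ℕ∞) := sInf_le ⟨k, rfl, h⟩
  calc ((absEarthmover f f' : ℕ∞) : ENNReal) ≤ ((k : ℕ∞) : ENNReal) := by exact_mod_cast h1
    _ = ENNReal.ofReal k := by simp
    _ ≤ ENNReal.ofReal (δ * ((numBase K n).choose 2 : ℕ)) := ENNReal.ofReal_le_ofReal hk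
    _ = _ := by rw [ENNReal.ofReal_mul hδ, ENNReal.ofReal_natCast]

lemma exists_movesIn_of_earthmover_le {α : Type*} {f f' : Obj K α n} {δ : ℝ} (hδ : 0 ≤ δ)
    (h : earthmover f f' ≤ ENNReal.ofReal δ) :
    ∃ k : ℕ, MovesIn k f f' ∧ (k : ℝ) ≤ δ * ((numBase K n).choose 2 : ℕ) := by
  have h1 : ((absEarthmover f f' : ℕ∞) : ENNReal) ≤
      ENNReal.ofReal δ * (((numBase K n).choose 2 : ℕ) : ENNReal) := by
    -- This also covers a zero denominator: in `ENNReal` a nonzero number divided by zero is `⊤`, so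
    -- the bound then forces zero moves.
    exact (ENNReal.div_le_iff_le_mul (Or.inr ENNReal.ofReal_ne_top)
      (Or.inl (ENNReal.natCast_ne_top _))).1 h
  have hne : absEarthmover f f' ≠ ⊤ := by
    intro htop
    rw [htop] at h1
    have := ENNReal.mul_lt_top (ENNReal.ofReal_lt_top (r := δ))
      (ENNReal.natCast_lt_top ((numBase K n).choose 2))
    simp only [ENat.toENNReal_top, top_le_iff] at h1
    exact this.ne h1
  have hs : {d : ℕ∞ | ∃ m : ℕ, d = (m : ℕ∞) ∧ MovesIn m f f'}.Nonempty := by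
    by_contra hcon
    rw [Set.not_nonempty_iff_eq_empty] at hcon
    exact hne (by rw [absEarthmover, hcon, sInf_empty])
  obtain ⟨k, hk, hm⟩ := csInf_mem hs
  refine ⟨k, hm, ?_⟩
  rw [show absEarthmover f f' = (k : ℕ∞) from hk] at h1
  have h2 : ENNReal.ofReal (k : ℝ) ≤ ENNReal.ofReal (δ * ((numBase K n).choose 2 : ℕ)) := by
    rw [ENNReal.ofReal_mul hδ, ENNReal.ofReal_natCast, ENNReal.ofReal_natCast]
    simpa using h1
  exact (ENNReal.ofReal_le_ofReal_iff (by positivity)).1 h2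

end Moves

/-! ### Averages over permutations and over samples -/

section Averages

variable {K : OrdKind} {m n : ℕ}

/-- Under a transitive family of bijections indexed by a group, the average over the group is the
average over the space. -/
lemma expect_act {G X : Type*} [Group G] [Fintype G] [Fintype X]
    (act : G → Equiv.Perm X) (htrans : ∀ x y, ∃ g₀, ∀ g, act g y = act (g * g₀) x)
    (h : X → ℝ) (x : X) : 𝔼 g, h (act g x) = 𝔼 y, h y := by
  have hconst : ∀ y, 𝔼 g, h (act g y) = 𝔼 g, h (act g x) := by
    intro y
    obtain ⟨g₀, hg⟩ := htrans x y
    exact Fintype.expect_equiv (Equiv.mulRight g₀) _ _ fun g => by rw [hg]; rfl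
  have : Nonempty X := ⟨x⟩
  -- Since the base point does not matter, it may be averaged as well; after exchanging the two
  -- averages, each `act g` is a bijection and disappears.
  calc 𝔼 g, h (act g x) = 𝔼 _y : X, 𝔼 g, h (act g x) := (Fintype.expect_const _).symm
    _ = 𝔼 y, 𝔼 g, h (act g y) := Finset.expect_congr rfl fun y _ => (hconst y).symm
    _ = 𝔼 g, 𝔼 y, h (act g y) := Finset.expect_comm _ _ _
    _ = 𝔼 _g : G, 𝔼 y, h y := Finset.expect_congr rfl fun g _ =>
        Fintype.expect_equiv (act g) _ _ fun _ => rfl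
    _ = 𝔼 y, h y := Fintype.expect_const _

/-- An injection is an increasing sequence together with the order in which it is read. Hence a
uniform injection is a uniform sample with an independent uniform order, which gives the simulation
its internal randomness. -/
lemma bijective_perm_trans_orderEmb :
    Function.Bijective fun p : (Fin m ↪o Fin n) × Equiv.Perm (Fin m) =>
      p.2.toEmbedding.trans p.1.toEmbedding := by
  constructor
  · rintro ⟨s, τ⟩ ⟨s', τ'⟩ h
    have h' : ∀ a, s (τ a) = s' (τ' a) := fun a => DFunLike.congr_fun h a
    have hr : Set.range s = Set.range s' := by
      rw [← τ.surjective.range_comp s, ← τ'.surjective.range_comp s']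
      exact congrArg Set.range (funext h')
    have hs : s = s' := DFunLike.coe_injective
      ((StrictMono.range_inj s.strictMono s'.strictMono).1 hr)
    subst hs
    exact Prod.ext rfl (Equiv.ext fun a => s.injective (h' a))
  · intro φ
    have hcard : (Finset.univ.map φ).card = m := by simp
    let s := (Finset.univ.map φ).orderEmbOfFin hcard
    have hr : ∀ a, φ a ∈ Set.range s := by
      intro a
      simp [s, Finset.range_orderEmbOfFin]
    choose t ht using hr
    have hinj : Function.Injective t := fun a b hab => φ.injective (by rw [← ht, ← ht, hab])
    exact ⟨(s, Equiv.ofBijective t (Finite.injective_iff_bijective.1 hinj)),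
      Function.Embedding.ext ht⟩

/-- The injections shown by a sample whose increasing sequences are read in the order `τ`. -/
def sampleEmb (s : Sample K m n) (τ : Axis K → Equiv.Perm (Fin m)) (x : Axis K) :
    Fin m ↪ Fin n :=
  (τ x).toEmbedding.trans (sampleEquiv K m n s x).toEmbedding

lemma bijective_sampleEmb :
    Function.Bijective fun p : Sample K m n × (Axis K → Equiv.Perm (Fin m)) =>
      sampleEmb p.1 p.2 := by
  let e : Sample K m n × (Axis K → Equiv.Perm (Fin m)) ≃ (Axis K → Fin m ↪ Fin n) :=
    ((sampleEquiv K m n).prodCongr (Equiv.refl _)).trans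
      ((Equiv.arrowProdEquivProdArrow _ _ _).symm.trans
        (Equiv.arrowCongr (Equiv.refl _) (Equiv.ofBijective _ bijective_perm_trans_orderEmb)))
  exact e.bijective

instance instNonemptySample (K : OrdKind) (m n : ℕ) : Nonempty (Sample K (min m n) n) :=
  ⟨(sampleEquiv K _ n).symm fun _ => Fin.castLEOrderEmb (min_le_right m n)⟩

lemma expect_perm_trans_eq_expect_embedding (w : Fin m ↪ Fin n)
    (G : (Axis K → Fin m ↪ Fin n) → ℝ) :
    𝔼 σ : Axis K → Equiv.Perm (Fin n), G (fun x => w.trans (σ x).toEmbedding) = 𝔼 φ, G φ := by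
  let act : (Axis K → Equiv.Perm (Fin n)) → Equiv.Perm (Axis K → Fin m ↪ Fin n) := fun σ =>
    { toFun := fun φ x => (φ x).trans (σ x).toEmbedding
      invFun := fun φ x => (φ x).trans (σ x).symm.toEmbedding
      left_inv := fun φ => by ext x a; simp
      right_inv := fun φ => by ext x a; simp }
  refine expect_act act ?_ G (fun _ => w)
  intro φ ψ
  choose g₀ hg using fun x => exists_perm_trans (φ x) (ψ x)
  refine ⟨g₀, fun g => ?_⟩
  funext x
  simp only [act, Equiv.coe_fn_mk, ← hg x]
  rfl

lemma expect_perm_trans_eq_expect_sample (w : Fin m ↪ Fin n)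
    (G : (Axis K → Fin m ↪ Fin n) → ℝ) :
    𝔼 σ : Axis K → Equiv.Perm (Fin n), G (fun x => w.trans (σ x).toEmbedding) =
      𝔼 s : Sample K m n, 𝔼 τ : Axis K → Equiv.Perm (Fin m), G (sampleEmb s τ) := by
  rw [expect_perm_trans_eq_expect_embedding, ← Finset.expect_product', Finset.univ_product_univ]
  exact (Fintype.expect_bijective _ bijective_sampleEmb _ _ fun _ => rfl).symm

/-- The expected sum over the items seen in a sample, for items on which the permutations act
transitively. -/
lemma expect_sample_sum {A B : Type*} [Fintype A] [Fintype B]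
    (ρ : (Axis K → Fin m ↪ Fin n) → A → B)
    (actA : (Axis K → Equiv.Perm (Fin m)) → Equiv.Perm A)
    (actB : (Axis K → Equiv.Perm (Fin n)) → Equiv.Perm B)
    (hA : ∀ τ φ a, ρ (fun x => (τ x).toEmbedding.trans (φ x)) a = ρ φ (actA τ a))
    (hB : ∀ σ φ a, ρ (fun x => (φ x).trans (σ x).toEmbedding) a = actB σ (ρ φ a))
    (hmul : ∀ σ σ' b, actB (σ * σ') b = actB σ (actB σ' b))
    (htrans : ∀ b b', ∃ σ, actB σ b = b') (w : Fin m ↪ Fin n) (h : B → ℝ) :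
    𝔼 s : Sample K m n, ∑ a, h (ρ (fun x => (sampleEquiv K m n s x).toEmbedding) a) =
      Fintype.card A * 𝔼 b, h b := by
  have h1 : ∀ a, 𝔼 σ : Axis K → Equiv.Perm (Fin n),
      h (ρ (fun x => w.trans (σ x).toEmbedding) a) = 𝔼 b, h b := by
    intro a
    simp only [hB _ (fun _ => w)]
    refine expect_act actB (fun b b' => ?_) h _
    obtain ⟨g, rfl⟩ := htrans b b'
    exact ⟨g, fun g' => (hmul g' g b).symm⟩
  have h2 : 𝔼 σ : Axis K → Equiv.Perm (Fin n),
      ∑ a, h (ρ (fun x => w.trans (σ x).toEmbedding) a) = Fintype.card A * 𝔼 b, h b := by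
    rw [Finset.expect_sum_comm, Finset.sum_congr rfl fun a _ => h1 a]
    simp
  rw [← h2, expect_perm_trans_eq_expect_sample w fun φ => ∑ a, h (ρ φ a)]
  refine Finset.expect_congr rfl fun s _ => ?_
  -- Reading the sample in another order only permutes the items seen, so the sum over all items
  -- ignores `τ`.
  have h3 : ∀ τ : Axis K → Equiv.Perm (Fin m), ∑ a, h (ρ (sampleEmb s τ) a) =
      ∑ a, h (ρ (fun x => (sampleEquiv K m n s x).toEmbedding) a) := by
    intro τ
    rw [← Equiv.sum_comp (actA τ) fun a =>
      h (ρ (fun x => (sampleEquiv K m n s x).toEmbedding) a)]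
    exact Finset.sum_congr rfl fun a _ => congrArg h (hA _ _ a)
  simp only [h3]
  exact (Fintype.expect_const _).symm

lemma expect_sample_sum_entry (w : Fin m ↪ Fin n) (h : Entry K n → ℝ) :
    𝔼 s : Sample K m n, ∑ e, h (samplePull (sampleEquiv K m n s) e) =
      Fintype.card (Entry K m) * 𝔼 e, h e :=
  expect_sample_sum (fun φ => pull φ) permuteEquiv permuteEquiv
    (fun τ φ e => (pull_pull φ (fun x => (τ x).toEmbedding) e).symm)
    (fun σ φ e => (pull_pull (fun x => (σ x).toEmbedding) φ e).symm)
    permute_mul exists_permute_eq w h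

/-- The bijection of the pairs induced by a permutation. -/
def pairEquiv (σ : Equiv.Perm (Fin n)) : Equiv.Perm (Pair n) :=
  permuteEquiv (K := graph) fun _ => σ

lemma expect_sample_sum_pair (x : Axis K) (w : Fin m ↪ Fin n) (h : Pair n → ℝ) :
    𝔼 s : Sample K m n, ∑ e : Pair m, h (e.map (sampleEquiv K m n s x).toEmbedding) =
      Fintype.card (Pair m) * 𝔼 e, h e := by
  refine expect_sample_sum (fun φ => Pair.map (φ x)) (fun τ => pairEquiv (τ x))
    (fun σ => pairEquiv (σ x)) (fun τ φ e => ?_) (fun σ φ e => ?_) (fun σ σ' e => ?_)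
    (fun b b' => ?_) w h
  · exact Subtype.ext (Finset.map_map _ _ _).symm
  · exact Subtype.ext (Finset.map_map _ _ _).symm
  · exact permute_mul (K := graph) (fun _ => σ x) (fun _ => σ' x) e
  · obtain ⟨σ, hσ⟩ := exists_permute_eq (K := graph) b b'
    exact ⟨fun _ => σ (), hσ⟩

end Averages

/-! ### Stability of canonical algorithms -/

section Stability

variable {K : OrdKind} {α : Type*} {m n q : ℕ}

lemma card_pair (n : ℕ) : Fintype.card (Pair n) = n.choose 2 := by
  simp

lemma CanonicalAlgorithm.acceptProb_eq_expect (T : CanonicalAlgorithm K α q n) (f : Obj K α n) :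
    T.acceptProb f = 𝔼 s, (T.decision (restrict f s) : ℝ) :=
  (Fintype.expect_eq_sum_div_card _).symm

lemma abs_sub_le_one_of_mem_Icc (a b : Set.Icc (0 : ℝ) 1) : |(a : ℝ) - b| ≤ 1 :=
  abs_sub_le_iff.2 ⟨by linarith [a.2.2, b.2.1], by linarith [a.2.1, b.2.2]⟩

lemma relHamming_eq_expect [DecidableEq α] (f g : Obj K α n) :
    relHamming f g = 𝔼 e, if f e = g e then (0 : ℝ) else 1 := by
  rw [Fintype.expect_eq_sum_div_card, relHamming, hammingDist]
  congr 1
  rw [Finset.card_filter]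
  push_cast
  exact Finset.sum_congr rfl fun e _ => by by_cases h : f e = g e <;> simp [h]

/-- Union bound: the decisions can differ only on samples showing an entry where `f` and `g` differ,
so the difference is at most the expected number of such entries. -/
lemma CanonicalAlgorithm.abs_acceptProb_sub_le_relHamming [DecidableEq α]
    (T : CanonicalAlgorithm K α q n) (f g : Obj K α n) :
    |T.acceptProb f - T.acceptProb g| ≤
      Fintype.card (Entry K (min q n)) * relHamming f g := by
  rw [T.acceptProb_eq_expect, T.acceptProb_eq_expect, ← Finset.expect_sub_distrib,
    relHamming_eq_expect, ← expect_sample_sum_entry (Fin.castLEEmb (min_le_right q n))]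
  refine (Finset.abs_expect_le _ _).trans (Finset.expect_le_expect fun s _ => ?_)
  by_cases h : restrict f s = restrict g s
  · rw [h, sub_self, abs_zero]
    exact Finset.sum_nonneg fun e _ => by split_ifs <;> norm_num
  · obtain ⟨e, he⟩ := Function.ne_iff.1 h
    rw [restrict_eq, restrict_eq] at he
    refine (abs_sub_le_one_of_mem_Icc _ _).trans ?_
    refine le_trans ?_ (Finset.single_le_sum (f := fun e =>
      if f (samplePull (sampleEquiv K _ n s) e) = g (samplePull (sampleEquiv K _ n s) e)
      then (0 : ℝ) else 1) (fun e _ => ?_) (Finset.mem_univ e))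
    · simp [he]
    · split_ifs <;> norm_num

open Classical in
/-- Exchanging two consecutive elements in an increasing sequence that does not contain both. -/
noncomputable def swapOrderEmb (i j : Fin n) (hij : (j : ℕ) = i + 1) (s : Fin m ↪o Fin n) :
    Fin m ↪o Fin n :=
  if h : i ∈ Set.range s ∧ j ∈ Set.range s then s else
    OrderEmbedding.ofStrictMono (fun a => Equiv.swap i j (s a)) fun a b hab => by
      -- Exchanging two consecutive values reverses the order of no other pair of values.
      have h1 : ¬ (s a = i ∧ s b = j) := fun h' => h ⟨⟨a, h'.1⟩, ⟨b, h'.2⟩⟩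
      have h2 : s a < s b := s.strictMono hab
      dsimp only
      rw [Equiv.swap_apply_def, Equiv.swap_apply_def]
      simp only [Fin.ext_iff, Fin.lt_def] at *
      split_ifs <;> omega

lemma swapOrderEmb_of_mem {i j : Fin n} (hij : (j : ℕ) = i + 1) {s : Fin m ↪o Fin n}
    (h : i ∈ Set.range s ∧ j ∈ Set.range s) : swapOrderEmb i j hij s = s :=
  dif_pos h

lemma swapOrderEmb_apply {i j : Fin n} (hij : (j : ℕ) = i + 1) {s : Fin m ↪o Fin n}
    (h : ¬ (i ∈ Set.range s ∧ j ∈ Set.range s)) (a : Fin m) :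
    swapOrderEmb i j hij s a = Equiv.swap i j (s a) := by
  rw [swapOrderEmb, dif_neg h]
  rfl

lemma involutive_swapOrderEmb {i j : Fin n} (hij : (j : ℕ) = i + 1) :
    Function.Involutive (swapOrderEmb (m := m) i j hij) := by
  intro s
  by_cases h : i ∈ Set.range s ∧ j ∈ Set.range s
  · rw [swapOrderEmb_of_mem hij h, swapOrderEmb_of_mem hij h]
  · have h' : ¬ (i ∈ Set.range (swapOrderEmb i j hij s) ∧
        j ∈ Set.range (swapOrderEmb i j hij s)) := by
      rintro ⟨⟨a, ha⟩, ⟨b, hb⟩⟩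
      rw [swapOrderEmb_apply hij h, Equiv.swap_apply_eq_iff] at ha hb
      rw [Equiv.swap_apply_left] at ha
      rw [Equiv.swap_apply_right] at hb
      exact h ⟨⟨b, hb⟩, ⟨a, ha⟩⟩
    ext a : 1
    rw [swapOrderEmb_apply hij h', swapOrderEmb_apply hij h, Equiv.swap_apply_self]

/-- The event is counted by the pairs of sample positions that show `{i, j}`, each position showing
a uniform pair of `[n]`. -/
lemma expect_mem_range_le (x : Axis K) {i j : Fin n} (hij : i ≠ j) (w : Fin m ↪ Fin n)
    [DecidablePred fun s : Sample K m n =>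
      i ∈ Set.range (sampleEquiv K m n s x) ∧ j ∈ Set.range (sampleEquiv K m n s x)] :
    (𝔼 s : Sample K m n, if i ∈ Set.range (sampleEquiv K m n s x) ∧
      j ∈ Set.range (sampleEquiv K m n s x) then (1 : ℝ) else 0) ≤
      (m.choose 2 : ℕ) / (n.choose 2 : ℕ) := by
  let p : Pair n := ⟨{i, j}, Finset.card_pair hij⟩
  have h : (m.choose 2 : ℕ) / ((n.choose 2 : ℕ) : ℝ) =
      Fintype.card (Pair m) * 𝔼 e : Pair n, if e = p then (1 : ℝ) else 0 := by
    rw [Fintype.expect_eq_sum_div_card, Finset.sum_ite_eq' Finset.univ p, card_pair, card_pair]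
    simp [div_eq_mul_inv]
  rw [h, ← expect_sample_sum_pair x w]
  refine Finset.expect_le_expect fun s _ => ?_
  have hnn : ∀ e ∈ (Finset.univ : Finset (Pair m)),
      0 ≤ if Pair.map (sampleEquiv K m n s x).toEmbedding e = p then (1 : ℝ) else 0 :=
    fun e _ => by split_ifs <;> norm_num
  split_ifs with h1
  · obtain ⟨⟨a, ha⟩, ⟨b, hb⟩⟩ := h1
    have hab : a ≠ b := fun h => hij (by rw [← ha, ← hb, h])
    refine le_trans ?_ (Finset.single_le_sum hnn
      (Finset.mem_univ (⟨{a, b}, Finset.card_pair hab⟩ : Pair m)))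
    rw [if_pos]
    refine Subtype.ext ?_
    change Finset.map _ {a, b} = {i, j}
    rw [← ha, ← hb]
    simp
  · exact Finset.sum_nonneg hnn

/-- Coupling: unless a sample contains both `i` and `j`, it shows in `f'` what the sample with `i`
and `j` exchanged shows in `f`. This exchange is an involution of the samples, so only samples
containing both contribute. -/
lemma CanonicalAlgorithm.abs_acceptProb_sub_le_of_basicMove (T : CanonicalAlgorithm K α q n)
    {f f' : Obj K α n} (h : BasicMove K f f') :
    |T.acceptProb f' - T.acceptProb f| ≤ ((min q n).choose 2 : ℕ) / (n.choose 2 : ℕ) := by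
  classical
  obtain ⟨x, i, j, hij, rfl⟩ := (basicMove_iff f f').1 h
  have hne : i ≠ j := by
    rintro rfl
    omega
  let Φ' : (Axis K → Fin (min q n) ↪o Fin n) → (Axis K → Fin (min q n) ↪o Fin n) :=
    fun s => Function.update s x (swapOrderEmb i j hij (s x))
  have hΦ' : Function.Involutive Φ' := by
    intro s
    simp [Φ', involutive_swapOrderEmb hij (s x)]
  let Φ : Equiv.Perm (Sample K (min q n) n) :=
    (sampleEquiv K _ n).trans (hΦ'.toPerm.trans (sampleEquiv K _ n).symm)
  have hkey : ∀ s, ¬ (i ∈ Set.range (sampleEquiv K _ n s x) ∧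
      j ∈ Set.range (sampleEquiv K _ n s x)) →
      restrict (fun e => f (permute (Pi.mulSingle x (Equiv.swap i j)) e)) s =
        restrict f (Φ s) := by
    intro s hs
    rw [restrict_eq, restrict_eq]
    funext e
    rw [permute, samplePull, pull_pull]
    refine congrArg f (pull_congr fun y a _ => ?_)
    have hΦs : sampleEquiv K _ n (Φ s) = Φ' (sampleEquiv K _ n s) := by
      simp [Φ]
    rw [hΦs]
    by_cases hy : y = x
    · subst hy
      simp [Φ', swapOrderEmb_apply hij hs]
    · simp [Φ', hy]
  rw [T.acceptProb_eq_expect, T.acceptProb_eq_expect,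
    ← Fintype.expect_equiv Φ (fun s => (T.decision (restrict f (Φ s)) : ℝ))
      (fun s => (T.decision (restrict f s) : ℝ)) fun _ => rfl,
    ← Finset.expect_sub_distrib]
  refine (Finset.abs_expect_le _ _).trans (le_trans (Finset.expect_le_expect fun s _ => ?_)
    (expect_mem_range_le x hne (Fin.castLEEmb (min_le_right q n))))
  split_ifs with hs
  · exact abs_sub_le_one_of_mem_Icc _ _
  · rw [hkey s hs, sub_self, abs_zero]

lemma CanonicalAlgorithm.abs_acceptProb_sub_le_of_movesIn (T : CanonicalAlgorithm K α q n)
    {k : ℕ} {f f' : Obj K α n} (h : MovesIn k f f') :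
    |T.acceptProb f' - T.acceptProb f| ≤ k * (((min q n).choose 2 : ℕ) / (n.choose 2 : ℕ)) := by
  induction h with
  | zero f => simp
  | succ _ hb ih =>
    have h1 := T.abs_acceptProb_sub_le_of_basicMove hb
    refine (abs_sub_le _ _ _).trans ((add_le_add h1 ih).trans ?_)
    push_cast
    linarith

end Stability

/-! ### Query algorithms: construction and amplification -/

lemma sum_toReal_pmf {X : Type*} [Fintype X] (p : PMF X) : ∑ x, (p x).toReal = 1 := by
  rw [← ENNReal.toReal_sum fun x _ => p.apply_ne_top x,
    ← tsum_fintype (L := SummationFilter.unconditional _), p.tsum_coe, ENNReal.toReal_one]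

/-- The total probability of the preimage of a point. -/
lemma toReal_map_apply {Ω X : Type*} [Fintype Ω] [DecidableEq X] (p : PMF Ω) (Q : Ω → X)
    (S : X) :
    ((p.map Q) S).toReal = ∑ ω, if Q ω = S then (p ω).toReal else 0 := by
  rw [PMF.map_apply, tsum_fintype, ENNReal.toReal_sum]
  · refine Finset.sum_congr rfl fun ω _ => ?_
    by_cases h : Q ω = S
    · simp [h]
    · simp [h, Ne.symm h]
  · intro ω _
    split_ifs
    · exact p.apply_ne_top ω
    · exact ENNReal.zero_ne_top

section Query

variable {E α : Type*} [Fintype E]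

/-- A procedure that draws a seed, queries a set depending on the seed and decides depending on the
seed and on the answers is equivalent to a query algorithm. -/
lemma exists_queryAlgorithm {Ω : Type*} [Fintype Ω] {q : ℕ} (p : PMF Ω) (Q : Ω → Finset E)
    (hQ : ∀ ω ∈ p.support, (Q ω).card ≤ q) (dec : (ω : Ω) → (Q ω → α) → Set.Icc (0 : ℝ) 1) :
    ∃ T : QueryAlgorithm E α q, ∀ f,
      T.acceptProb f = ∑ ω, (p ω).toReal * (dec ω (fun x => f x.1) : ℝ) := by
  classical
  let W : Finset E → ℝ := fun S => ∑ ω, if Q ω = S then (p ω).toReal else 0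
  let N : (S : Finset E) → (S → α) → ℝ := fun S v => ∑ ω, if h : Q ω = S then
    (p ω).toReal * (dec ω (fun x => v ⟨x.1, h ▸ x.2⟩) : ℝ) else 0
  have hN0 : ∀ S v, 0 ≤ N S v := fun S v => Finset.sum_nonneg fun ω _ => by
    split_ifs
    · exact mul_nonneg ENNReal.toReal_nonneg (dec ω _).2.1
    · exact le_rfl
  have hNW : ∀ S v, N S v ≤ W S := fun S v => Finset.sum_le_sum fun ω _ => by
    split_ifs
    · exact mul_le_of_le_one_right ENNReal.toReal_nonneg (dec ω _).2.2
    · exact le_rfl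
  -- Given the query set `S`, accept with the conditional expectation of `dec` over the seeds that
  -- query `S`. If `W S = 0` the quotient is zero by convention, harmlessly, because `N S v`
  -- vanishes too.
  refine ⟨⟨p.map Q, ?_, fun S v => ⟨N S v / W S,
    div_nonneg (hN0 S v) ((hN0 S v).trans (hNW S v)),
    div_le_one_of_le₀ (hNW S v) ((hN0 S v).trans (hNW S v))⟩⟩, fun f => ?_⟩
  · intro S hS
    rw [PMF.support_map] at hS
    obtain ⟨ω, hω, rfl⟩ := hS
    exact hQ ω hω
  · have h1 : ∀ S : Finset E, ((p.map Q) S).toReal * (N S (fun x => f x.1) / W S) =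
        N S (fun x => f x.1) := by
      intro S
      rw [toReal_map_apply]
      rcases eq_or_ne (W S) 0 with h | h
      · have : N S (fun x => f x.1) = 0 := le_antisymm ((hNW S fun x => f x.1).trans h.le) (hN0 S fun x => f x.1)
        rw [this, zero_div, mul_zero]
      · exact mul_div_cancel₀ _ h
    refine (Finset.sum_congr rfl fun S _ => h1 S).trans ?_
    simp only [N]
    rw [Finset.sum_comm]
    refine Finset.sum_congr rfl fun ω _ => ?_
    rw [Finset.sum_dite_eq Finset.univ (Q ω)
      (fun S h => (p ω).toReal * (dec ω (fun x => f x.1) : ℝ))]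
    simp

/-- The second moment of a sum of independent centered variables bounded by one. -/
lemma sum_prod_mul_sq_sum_le {X : Type*} [Fintype X] (w g : X → ℝ) (hw : ∀ x, 0 ≤ w x)
    (hw1 : ∑ x, w x = 1) (hg : ∀ x, |g x| ≤ 1) (hg0 : ∑ x, w x * g x = 0) (r : ℕ) :
    ∑ ω : Fin r → X, (∏ k, w (ω k)) * (∑ i, g (ω i)) ^ 2 ≤ r := by
  classical
  have hprod : ∀ u : Fin r → X → ℝ, ∑ ω : Fin r → X, ∏ k, u k (ω k) = ∏ k, ∑ x, u k x := by
    intro u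
    rw [Finset.prod_univ_sum, Fintype.piFinset_univ]
  -- The sum over `ω` factors over the coordinates. For `i ≠ j` the factor at `i` is the mean of
  -- `g`, which is zero; for `i = j` every factor is at most one.
  have hterm : ∀ i j : Fin r, ∑ ω : Fin r → X, (∏ k, w (ω k)) * (g (ω i) * g (ω j)) ≤
      if i = j then 1 else 0 := by
    intro i j
    have h1 : ∀ ω : Fin r → X, (∏ k, w (ω k)) * (g (ω i) * g (ω j)) =
        ∏ k, w (ω k) * ((if k = i then g (ω k) else 1) * (if k = j then g (ω k) else 1)) := by
      intro ω
      rw [Finset.prod_mul_distrib, Finset.prod_mul_distrib]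
      simp
    simp only [h1]
    rw [hprod fun k x => w x * ((if k = i then g x else 1) * (if k = j then g x else 1))]
    split_ifs with hij
    · subst hij
      refine Finset.prod_le_one (fun k _ => Finset.sum_nonneg fun x _ => ?_) fun k _ => ?_
      · refine mul_nonneg (hw x) ?_
        split_ifs
        · exact mul_self_nonneg _
        · norm_num
      · refine le_of_le_of_eq (Finset.sum_le_sum fun x _ => ?_) hw1
        refine mul_le_of_le_one_right (hw x) ?_
        split_ifs
        · rw [← abs_mul_abs_self]
          exact mul_le_one₀ (hg x) (abs_nonneg _) (hg x)
        · norm_num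
    · refine (Finset.prod_eq_zero (Finset.mem_univ i) ?_).le
      simpa [hij] using hg0
  calc ∑ ω : Fin r → X, (∏ k, w (ω k)) * (∑ i, g (ω i)) ^ 2
      = ∑ i, ∑ j, ∑ ω : Fin r → X, (∏ k, w (ω k)) * (g (ω i) * g (ω j)) := by
        simp_rw [sq, Finset.sum_mul_sum, Finset.mul_sum]
        rw [Finset.sum_comm]
        exact Finset.sum_congr rfl fun i _ => Finset.sum_comm
    _ ≤ ∑ i : Fin r, ∑ j, (if i = j then 1 else 0 : ℝ) :=
        Finset.sum_le_sum fun i _ => Finset.sum_le_sum fun j _ => hterm i j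
    _ = r := by simp

/-- Chebyshev's inequality for the mean of independent variables with values in `[0, 1]`. -/
lemma sum_prod_indicator_le {X : Type*} [Fintype X] (w d : X → ℝ) (hw : ∀ x, 0 ≤ w x)
    (hw1 : ∑ x, w x = 1) (hd : ∀ x, d x ∈ Set.Icc (0 : ℝ) 1) {r : ℕ} (hr : 0 < r) {t : ℝ}
    (ht : 0 < t) (A : (Fin r → X) → Prop) [DecidablePred A]
    (hA : ∀ ω, A ω → r * t ≤ |∑ i, d (ω i) - r * ∑ x, w x * d x|) :
    ∑ ω : Fin r → X, (∏ k, w (ω k)) * (if A ω then 1 else 0) ≤ 1 / (r * t ^ 2) := by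
  set μ := ∑ x, w x * d x with hμ
  have hμ0 : 0 ≤ μ := Finset.sum_nonneg fun x _ => mul_nonneg (hw x) (hd x).1
  have hμ1 : μ ≤ 1 := by
    rw [← hw1]
    exact Finset.sum_le_sum fun x _ => mul_le_of_le_one_right (hw x) (hd x).2
  have h1 := sum_prod_mul_sq_sum_le w (fun x => d x - μ) hw hw1
    (fun x => abs_le.2 ⟨by linarith [(hd x).1], by linarith [(hd x).2]⟩)
    (by simp only [mul_sub, Finset.sum_sub_distrib, ← Finset.sum_mul, hw1]; rw [← hμ]; ring) r
  have hr' : (0 : ℝ) < r := by exact_mod_cast hr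
  have h2 : ∀ ω : Fin r → X, (∏ k, w (ω k)) * (if A ω then 1 else 0) ≤
      (∏ k, w (ω k)) * (∑ i, (d (ω i) - μ)) ^ 2 / (r * t) ^ 2 := by
    intro ω
    rw [mul_div_assoc]
    refine mul_le_mul_of_nonneg_left ?_ (Finset.prod_nonneg fun k _ => hw _)
    split_ifs with h
    · have h3 := hA ω h
      rw [one_le_div (by positivity), ← sq_abs (∑ i, (d (ω i) - μ))]
      have h4 : ∑ i, (d (ω i) - μ) = ∑ i, d (ω i) - r * μ := by
        simp [Finset.sum_sub_distrib]
      rw [h4]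
      exact pow_le_pow_left₀ (by positivity) h3 2
    · positivity
  refine (Finset.sum_le_sum fun ω _ => h2 ω).trans ?_
  rw [← Finset.sum_div, div_le_div_iff₀ (by positivity) (by positivity)]
  nlinarith [mul_le_mul_of_nonneg_right h1 (show (0 : ℝ) ≤ r * t ^ 2 by positivity)]

/-- Independent draws from a distribution on a finite type. -/
noncomputable def iidPMF {X : Type*} [Fintype X] (p : PMF X) (r : ℕ) : PMF (Fin r → X) :=
  PMF.ofFintype (fun ω => ∏ k, p (ω k)) <| by
    classical
    have h : ∑ x, p x = 1 := by
      rw [← tsum_fintype (L := SummationFilter.unconditional X), p.tsum_coe]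
    have := Finset.prod_univ_sum (fun _ : Fin r => (Finset.univ : Finset X)) fun _ x => p x
    rw [Fintype.piFinset_univ] at this
    rw [← this, h]
    simp

/-- Draw `r` independent query sets, read their union and compare the sum of the `r` acceptance
probabilities with `r * θ`. These numbers need not be rounded to verdicts: Chebyshev's inequality
applies to any variables in `[0, 1]`. -/
lemma QueryAlgorithm.exists_amplification {q : ℕ} (T : QueryAlgorithm E α q) {r : ℕ} (hr : 0 < r)
    {t : ℝ} (ht : 0 < t) (θ : ℝ) :
    ∃ T' : QueryAlgorithm E α (r * q), ∀ f,
      (θ + t ≤ T.acceptProb f → 1 - 1 / (r * t ^ 2) ≤ T'.acceptProb f) ∧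
      (T.acceptProb f ≤ θ - t → T'.acceptProb f ≤ 1 / (r * t ^ 2)) := by
  classical
  let Q : (Fin r → Finset E) → Finset E := fun ω => Finset.univ.biUnion ω
  let D : (ω : Fin r → Finset E) → (Q ω → α) → ℝ := fun ω v =>
    ∑ i, (T.decision (ω i)
      (fun x => v ⟨x.1, Finset.mem_biUnion.2 ⟨i, Finset.mem_univ i, x.2⟩⟩) : ℝ)
  obtain ⟨T', hT'⟩ := exists_queryAlgorithm (q := r * q) (iidPMF T.queries r) Q
    (fun ω hω => by
      refine Finset.card_biUnion_le.trans ?_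
      have : ∀ i ∈ (Finset.univ : Finset (Fin r)), (ω i).card ≤ q := by
        intro i _
        refine T.card_le _ ?_
        rw [PMF.mem_support_iff] at hω ⊢
        exact fun h0 => hω (Finset.prod_eq_zero (Finset.mem_univ i) h0)
      simpa using Finset.sum_le_card_nsmul _ _ _ this)
    (fun ω v => if r * θ ≤ D ω v then ⟨1, by norm_num⟩ else ⟨0, by norm_num⟩)
  refine ⟨T', fun f => ?_⟩
  let w : Finset E → ℝ := fun S => (T.queries S).toReal
  let d : Finset E → ℝ := fun S => T.decision S (fun x => f x.1)
  have hw : ∀ S, 0 ≤ w S := fun S => ENNReal.toReal_nonneg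
  have hw1 : ∑ S, w S = 1 := sum_toReal_pmf T.queries
  have hd : ∀ S, d S ∈ Set.Icc (0 : ℝ) 1 := fun S => (T.decision S _).2
  have hacc : T.acceptProb f = ∑ S, w S * d S := rfl
  have hacc' : T'.acceptProb f = ∑ ω : Fin r → Finset E, (∏ k, w (ω k)) *
      (if r * θ ≤ ∑ i, d (ω i) then 1 else 0) := by
    rw [hT']
    refine Finset.sum_congr rfl fun ω _ => ?_
    congr 1
    · simp [iidPMF, w, ENNReal.toReal_prod]
    · simp only [D, d]
      split_ifs <;> rfl
  have hr' : (0 : ℝ) < r := by exact_mod_cast hr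
  have htot : ∑ ω : Fin r → Finset E, ∏ k, w (ω k) = 1 := by
    have := Finset.prod_univ_sum (fun _ : Fin r => (Finset.univ : Finset (Finset E))) fun _ x => w x
    rw [Fintype.piFinset_univ] at this
    rw [← this, hw1]
    simp
  constructor
  · intro h
    have h1 := sum_prod_indicator_le w d hw hw1 hd hr ht
      (fun ω => ¬ r * θ ≤ ∑ i, d (ω i)) (fun ω hω => by
        rw [← hacc]
        rw [not_le] at hω
        refine le_trans ?_ (neg_le_abs _)
        nlinarith)
    have h2 : ∑ ω : Fin r → Finset E, (∏ k, w (ω k)) *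
        (if ¬ r * θ ≤ ∑ i, d (ω i) then 1 else 0) = 1 - T'.acceptProb f := by
      rw [hacc', eq_sub_iff_add_eq, ← Finset.sum_add_distrib]
      refine (Finset.sum_congr rfl fun ω _ => ?_).trans htot
      split_ifs <;> ring
    linarith
  · intro h
    rw [hacc']
    refine sum_prod_indicator_le w d hw hw1 hd hr ht _ (fun ω hω => ?_)
    rw [← hacc]
    refine le_trans ?_ (le_abs_self _)
    nlinarith

end Query

/-! ### Sorting a permutation inside classes -/

section ClassSort

variable {n : ℕ} {β : Type*} [LinearOrder β]

/-- The permutation that preserves the classes of `cl` and makes `φ` increasing on each of them. -/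
def classSort (cl : Fin n → ℕ) (φ : Fin n → β) : Equiv.Perm (Fin n) :=
  (Tuple.sort fun a => toLex (cl a, a)).symm.trans (Tuple.sort fun a => toLex (cl a, φ a))

lemma monotone_comp_sort_toLex (cl : Fin n → ℕ) (φ : Fin n → β) :
    Monotone (cl ∘ Tuple.sort fun a => toLex (cl a, φ a)) := by
  intro a b hab
  have h := Tuple.monotone_sort (fun a => toLex (cl a, φ a)) hab
  exact Prod.Lex.monotone_fst _ _ h

/-- The orders by (class, position) and by (class, value) list the classes in the same consecutive
blocks, so passing to the element of equal rank in the other order stays in the class. -/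
lemma apply_classSort (cl : Fin n → ℕ) (φ : Fin n → β) (a : Fin n) :
    cl (classSort cl φ a) = cl a := by
  have h := Tuple.unique_monotone (monotone_comp_sort_toLex cl φ)
    (monotone_comp_sort_toLex cl fun a => a)
  have h1 := congrFun h ((Tuple.sort fun a => toLex (cl a, a)).symm a)
  simpa [classSort] using h1

lemma comp_classSort_lt (cl : Fin n → ℕ) {φ : Fin n → β} (hφ : Function.Injective φ)
    {a b : Fin n} (hcl : cl a = cl b) (hab : a < b) :
    φ (classSort cl φ a) < φ (classSort cl φ b) := by
  set p₀ := Tuple.sort fun a => toLex (cl a, a) with hp₀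
  have h1 : p₀.symm a < p₀.symm b := by
    by_contra hcon
    have h := Tuple.monotone_sort (fun a => toLex (cl a, a)) (not_lt.1 hcon)
    simp only [Function.comp_apply, ← hp₀, Equiv.apply_symm_apply, Prod.Lex.toLex_le_toLex, hcl,
      lt_irrefl, true_and, false_or] at h
    exact absurd hab (not_lt.2 h)
  have h2 := Tuple.monotone_sort (fun a => toLex (cl a, φ a)) h1.le
  change toLex (cl (classSort cl φ a), φ (classSort cl φ a)) ≤
    toLex (cl (classSort cl φ b), φ (classSort cl φ b)) at h2
  simp only [Prod.Lex.toLex_le_toLex, apply_classSort, hcl, lt_irrefl, true_and, false_or] at h2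
  exact lt_of_le_of_ne h2 fun h => hab.ne ((classSort cl φ).injective (hφ h))

/-- Two maps that are increasing on a set of indices and have the same image on it agree there. -/
lemma eq_of_strictMonoOn_of_image_eq {g h : Fin n → β} {C : Set (Fin n)} (hg : StrictMonoOn g C)
    (hh : StrictMonoOn h C) (him : g '' C = h '' C) {a : Fin n} (ha : a ∈ C) : g a = h a := by
  have h1 : StrictMono (C.domRestrict g) := fun x y hxy => hg x.2 y.2 hxy
  have h2 : StrictMono (C.domRestrict h) := fun x y hxy => hh x.2 y.2 hxy
  have h3 : C.domRestrict g = C.domRestrict h :=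
    (StrictMono.range_inj h1 h2).1 (by rw [Set.range_domRestrict, Set.range_domRestrict, him])
  exact congrFun h3 ⟨a, ha⟩

/-- The rearrangement of `σ` that is increasing on each class. -/
def classPerm (cl : Fin n → ℕ) (σ : Equiv.Perm (Fin n)) : Equiv.Perm (Fin n) :=
  σ * classSort cl σ

lemma classPerm_lt (cl : Fin n → ℕ) (σ : Equiv.Perm (Fin n)) {a b : Fin n} (hcl : cl a = cl b)
    (hab : a < b) : classPerm cl σ a < classPerm cl σ b :=
  comp_classSort_lt cl σ.injective hcl hab

lemma image_comp_classSort (cl : Fin n → ℕ) (φ : Fin n → β) (c : ℕ) :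
    (φ ∘ classSort cl φ) '' {a | cl a = c} = φ '' {a | cl a = c} := by
  rw [Set.image_comp]
  congr 1
  ext b
  constructor
  · rintro ⟨a, ha, rfl⟩
    exact (apply_classSort cl φ a).trans ha
  · intro hb
    refine ⟨(classSort cl φ).symm b, ?_, by simp⟩
    have := apply_classSort cl φ ((classSort cl φ).symm b)
    rw [Equiv.apply_symm_apply] at this
    exact this.symm.trans hb

/-- Count `|π a - a|` by the thresholds `x` that separate `a` from `π a`. Since `π` is increasing on
a class, the elements with `a < x` and those with `π a < x` are both initial segments of the class.
They are nested, so the number of separated elements is the difference of their sizes, and sorting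
does not change the size for `σ`. -/
lemma displacement_classPerm_le (cl : Fin n → ℕ) (σ : Equiv.Perm (Fin n)) {L : ℕ}
    (hL : ∀ a, cl a < L) :
    (displacement (classPerm cl σ) : ℝ) ≤ ∑ x ∈ Finset.range n, ∑ c ∈ Finset.range L,
      |((Finset.univ.filter fun a : Fin n => cl a = c ∧ (a : ℕ) < x).card : ℝ) -
        (Finset.univ.filter fun a : Fin n => cl a = c ∧ (σ a : ℕ) < x).card| := by
  classical
  set π := classPerm cl σ with hπ
  have h1 : ∀ a : Fin n, ((π a : ℕ) - a) + ((a : ℕ) - π a) =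
      ∑ x ∈ Finset.range n, ((if (a : ℕ) < x ∧ x ≤ π a then 1 else 0) +
        (if (π a : ℕ) < x ∧ x ≤ a then 1 else 0)) := by
    intro a
    rw [Finset.sum_add_distrib, ← Finset.card_filter, ← Finset.card_filter]
    congr 1
    · rw [← Nat.card_Ioc]
      congr 1
      ext x
      simp only [Finset.mem_Ioc, Finset.mem_filter, Finset.mem_range]
      have := (π a).2
      omega
    · rw [← Nat.card_Ioc]
      congr 1
      ext x
      simp only [Finset.mem_Ioc, Finset.mem_filter, Finset.mem_range]
      have := a.2
      omega
  have h2 : ∀ x : ℕ, ∀ c : ℕ,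
      ((∑ a ∈ Finset.univ.filter (fun a => cl a = c), ((if (a : ℕ) < x ∧ x ≤ π a then 1 else 0) +
        (if (π a : ℕ) < x ∧ x ≤ a then 1 else 0)) : ℕ) : ℝ) ≤
      |((Finset.univ.filter fun a : Fin n => cl a = c ∧ (a : ℕ) < x).card : ℝ) -
        (Finset.univ.filter fun a : Fin n => cl a = c ∧ (σ a : ℕ) < x).card| := by
    intro x c
    set A := Finset.univ.filter fun a : Fin n => cl a = c ∧ (a : ℕ) < x with hA
    set B := Finset.univ.filter fun a : Fin n => cl a = c ∧ (π a : ℕ) < x with hB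
    have hcard : (Finset.univ.filter fun a : Fin n => cl a = c ∧ (σ a : ℕ) < x).card =
        B.card := by
      refine (Finset.card_equiv (classSort cl σ) fun a => ?_).symm
      simp [hB, hπ, classPerm, apply_classSort]
    have hsum : ∑ a ∈ Finset.univ.filter (fun a => cl a = c),
        ((if (a : ℕ) < x ∧ x ≤ π a then 1 else 0) + (if (π a : ℕ) < x ∧ x ≤ a then 1 else 0)) =
        (A \ B).card + (B \ A).card := by
      rw [Finset.sum_add_distrib, ← Finset.card_filter, ← Finset.card_filter,
        Finset.filter_filter, Finset.filter_filter]
      congr 2 <;>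
      · ext a
        simp only [hA, hB, Finset.mem_filter, Finset.mem_sdiff, Finset.mem_univ, true_and]
        constructor
        · rintro ⟨h, h', h''⟩
          exact ⟨⟨h, h'⟩, fun h3 => by omega⟩
        · rintro ⟨⟨h, h'⟩, h''⟩
          exact ⟨h, h', by by_contra h3; exact h'' ⟨h, by omega⟩⟩
    rw [hcard, hsum]
    have hsub : A ⊆ B ∨ B ⊆ A := by
      by_contra! hcon
      obtain ⟨a, haA, haB⟩ := Finset.not_subset.1 hcon.1
      obtain ⟨b, hbB, hbA⟩ := Finset.not_subset.1 hcon.2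
      simp only [hA, hB, Finset.mem_filter, Finset.mem_univ, true_and, not_and, not_lt] at *
      have hab : a < b := Fin.lt_def.2 (haA.2.trans_le (hbA hbB.1))
      have := Fin.lt_def.1 (classPerm_lt cl σ (haA.1.trans hbB.1.symm) hab)
      have h3 := haB haA.1
      have h4 := hbB.2
      rw [hπ] at h3 h4
      omega
    rcases hsub with h | h
    · rw [Finset.sdiff_eq_empty_iff_subset.2 h, Finset.card_empty, zero_add,
        Finset.card_sdiff_of_subset h, Nat.cast_sub (Finset.card_le_card h), abs_sub_comm]
      exact le_abs_self _
    · rw [Finset.sdiff_eq_empty_iff_subset.2 h, Finset.card_empty, add_zero,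
        Finset.card_sdiff_of_subset h, Nat.cast_sub (Finset.card_le_card h)]
      exact le_abs_self _
  have h3 : displacement π = ∑ x ∈ Finset.range n, ∑ c ∈ Finset.range L,
      ∑ a ∈ Finset.univ.filter (fun a => cl a = c), ((if (a : ℕ) < x ∧ x ≤ π a then 1 else 0) +
        (if (π a : ℕ) < x ∧ x ≤ a then 1 else 0)) := by
    rw [displacement, Finset.sum_congr rfl fun a _ => h1 a, Finset.sum_comm]
    exact Finset.sum_congr rfl fun x _ =>
      (Finset.sum_fiberwise_of_maps_to (fun a _ => Finset.mem_range.2 (hL a)) _).symm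
  rw [h3]
  push_cast
  exact Finset.sum_le_sum fun x _ => Finset.sum_le_sum fun c _ => by
    simpa using h2 x c

/-- Sampling without replacement has at most the second moment of sampling with replacement. -/
lemma expect_sq_sum_apply_le (g : Fin n → ℝ) (hg0 : ∑ y, g y = 0) (hg : ∀ y, |g y| ≤ 1)
    (C : Finset (Fin n)) : 𝔼 σ : Equiv.Perm (Fin n), (∑ a ∈ C, g (σ a)) ^ 2 ≤ C.card := by
  classical
  let M : Fin n → Fin n → ℝ := fun a b => 𝔼 σ : Equiv.Perm (Fin n), g (σ a) * g (σ b)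
  have hdiag : ∀ a, M a a ≤ 1 := fun a => by
    refine (Finset.expect_le_expect (g := fun _ => (1 : ℝ)) fun σ _ => ?_).trans
      (Fintype.expect_const _).le
    rw [← abs_mul_abs_self]
    exact mul_le_one₀ (hg _) (abs_nonneg _) (hg _)
  have hdiag0 : ∀ a, 0 ≤ M a a := fun a => Finset.expect_nonneg fun σ _ => mul_self_nonneg _
  have hsum : ∀ a, ∑ b, M a b = 0 := by
    intro a
    simp only [M]
    rw [← Finset.expect_sum_comm]
    refine Finset.expect_eq_zero fun σ _ => ?_
    rw [← Finset.mul_sum, Equiv.sum_comp σ g, hg0, mul_zero]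
  have heq : ∀ a b b', b ≠ a → b' ≠ a → M a b = M a b' := by
    intro a b b' hb hb'
    refine Fintype.expect_equiv (Equiv.mulRight (Equiv.swap b b')) _ _ fun σ => ?_
    simp [Equiv.swap_apply_of_ne_of_ne hb.symm hb'.symm]
  -- Negative correlation: by symmetry all off-diagonal entries of a row agree, the row sums to zero
  -- and its diagonal entry is nonnegative.
  have hoff : ∀ a b, a ≠ b → M a b ≤ 0 := by
    intro a b hab
    have h1 := hsum a
    rw [← Finset.add_sum_erase _ _ (Finset.mem_univ a),
      Finset.sum_congr rfl fun b' hb' => heq a b' b (Finset.ne_of_mem_erase hb') hab.symm,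
      Finset.sum_const, nsmul_eq_mul] at h1
    have hpos : (0 : ℝ) < ((Finset.univ.erase a).card : ℕ) := by
      exact_mod_cast Finset.card_pos.2 ⟨b, Finset.mem_erase.2 ⟨hab.symm, Finset.mem_univ b⟩⟩
    by_contra hcon
    nlinarith [mul_pos hpos (not_le.1 hcon), hdiag0 a]
  have hexp : 𝔼 σ : Equiv.Perm (Fin n), (∑ a ∈ C, g (σ a)) ^ 2 = ∑ a ∈ C, ∑ b ∈ C, M a b := by
    simp_rw [sq, Finset.sum_mul_sum]
    rw [Finset.expect_sum_comm]
    exact Finset.sum_congr rfl fun a _ => Finset.expect_sum_comm _ _ _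
  rw [hexp]
  calc ∑ a ∈ C, ∑ b ∈ C, M a b ≤ ∑ a ∈ C, ∑ b ∈ C, if a = b then (1 : ℝ) else 0 := by
        refine Finset.sum_le_sum fun a _ => Finset.sum_le_sum fun b _ => ?_
        split_ifs with h
        · exact h ▸ hdiag a
        · exact hoff a b h
    _ = C.card := by simp

/-- Both counts at a threshold are compared with `|C| * x / n`: the deterministic one is within 2 by
equidistribution, the random one has standard deviation at most `s`. This is summed over `n`
thresholds and `L` classes. -/
lemma expect_displacement_classPerm_le (cl : Fin n → ℕ) {L : ℕ} (hL : ∀ a, cl a < L) {s : ℕ}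
    (hs : 0 < s) (hcard : ∀ c, (Finset.univ.filter fun a => cl a = c).card ≤ s ^ 2)
    (hequi : ∀ x ≤ n, ∀ c < L,
      |((Finset.univ.filter fun a : Fin n => cl a = c ∧ (a : ℕ) < x).card : ℝ) -
        (Finset.univ.filter fun a => cl a = c).card * (x / n)| ≤ 2) :
    𝔼 σ : Equiv.Perm (Fin n), (displacement (classPerm cl σ) : ℝ) ≤ n * (L * (2 + s)) := by
  classical
  have hs' : (0 : ℝ) < s := by exact_mod_cast hs
  let g : ℕ → Fin n → ℝ := fun x y => (if (y : ℕ) < x then 1 else 0) - x / n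
  let C : ℕ → Finset (Fin n) := fun c => Finset.univ.filter fun a => cl a = c
  have hbound : ∀ σ : Equiv.Perm (Fin n), (displacement (classPerm cl σ) : ℝ) ≤
      ∑ x ∈ Finset.range n, ∑ c ∈ Finset.range L,
        (2 + ((∑ a ∈ C c, g x (σ a)) ^ 2 / s + s) / 2) := by
    intro σ
    refine (displacement_classPerm_le cl σ hL).trans (Finset.sum_le_sum fun x hx =>
      Finset.sum_le_sum fun c hc => ?_)
    have hg : ∑ a ∈ C c, g x (σ a) =
        ((Finset.univ.filter fun a : Fin n => cl a = c ∧ (σ a : ℕ) < x).card : ℝ) -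
          (C c).card * (x / n) := by
      simp only [g, Finset.sum_sub_distrib, Finset.sum_const, nsmul_eq_mul, C]
      rw [← Finset.filter_filter, Finset.card_filter (fun a => (σ a : ℕ) < x)]
      push_cast
      rfl
    have h1 := hequi x (Finset.mem_range.1 hx).le c (Finset.mem_range.1 hc)
    -- AM-GM replaces the absolute value by a second moment; the weight `s` is natural because that
    -- moment is at most `s ^ 2`.
    have h2 : |∑ a ∈ C c, g x (σ a)| ≤ ((∑ a ∈ C c, g x (σ a)) ^ 2 / s + s) / 2 := by
      set y := ∑ a ∈ C c, g x (σ a)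
      have h3 : (y ^ 2 / s + s) / 2 - |y| = (|y| - s) ^ 2 / (2 * s) := by
        rw [← sq_abs y]
        field_simp
        ring
      have h4 : 0 ≤ (|y| - s) ^ 2 / (2 * s) := by positivity
      linarith
    rw [hg] at h2
    calc _ ≤ _ := abs_sub_le _ ((C c).card * ((x : ℝ) / n)) _
      _ ≤ _ := by
        rw [hg]
        refine add_le_add h1 ?_
        rw [abs_sub_comm]
        exact h2
  refine (Finset.expect_le_expect fun σ _ => hbound σ).trans ?_
  rw [Finset.expect_sum_comm]
  have hx : ∀ x ∈ Finset.range n, 𝔼 σ : Equiv.Perm (Fin n), ∑ c ∈ Finset.range L,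
      ((2 : ℝ) + ((∑ a ∈ C c, g x (σ a)) ^ 2 / s + s) / 2) ≤ (L : ℝ) * (2 + s) := by
    intro x hx
    rw [Finset.mem_range] at hx
    have hn : (0 : ℝ) < n := by exact_mod_cast (Nat.zero_le x).trans_lt hx
    have hxn : (x : ℝ) / n ≤ 1 := (div_le_one hn).2 (by exact_mod_cast hx.le)
    have hxn0 : 0 ≤ (x : ℝ) / n := by positivity
    have hg0 : ∑ y, g x y = 0 := by
      simp only [g, Finset.sum_sub_distrib, Finset.sum_const, nsmul_eq_mul, Finset.card_univ,
        Fintype.card_fin]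
      have : (Finset.univ.filter fun y : Fin n => (y : ℕ) < x).card = x := by
        rw [Fin.card_filter_val_lt]
        exact min_eq_right hx.le
      have h2 : ∑ y : Fin n, (if (y : ℕ) < x then (1 : ℝ) else 0) = x := by
        rw [← Finset.sum_filter, Finset.sum_const, this, nsmul_eq_mul, mul_one]
      rw [h2]
      field_simp
      ring
    have hg1 : ∀ y, |g x y| ≤ 1 := by
      intro y
      simp only [g]
      split_ifs <;> rw [abs_le] <;> constructor <;> linarith
    rw [Finset.expect_sum_comm]
    have hc : ∀ c ∈ Finset.range L, 𝔼 σ : Equiv.Perm (Fin n),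
        ((2 : ℝ) + ((∑ a ∈ C c, g x (σ a)) ^ 2 / s + s) / 2) ≤ (2 : ℝ) + s := by
      intro c _
      have h1 := expect_sq_sum_apply_le (g x) hg0 hg1 (C c)
      have h2 : ((C c).card : ℝ) ≤ s ^ 2 := by exact_mod_cast hcard c
      rw [Finset.expect_add_distrib, Fintype.expect_const, ← Finset.expect_div,
        Finset.expect_add_distrib, Fintype.expect_const, ← Finset.expect_div]
      have h3 : (𝔼 σ : Equiv.Perm (Fin n), (∑ a ∈ C c, g x (σ a)) ^ 2) / s ≤ s := by
        rw [div_le_iff₀ hs', ← sq]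
        exact h1.trans h2
      linarith
    refine (Finset.sum_le_sum hc).trans ?_
    simp [mul_add]
  refine (Finset.sum_le_sum hx).trans ?_
  simp

lemma classPerm_eq_one_of_const (c : ℕ) (σ : Equiv.Perm (Fin n)) :
    classPerm (fun _ => c) σ = 1 := by
  have h : Monotone (classPerm (fun _ => c) σ) := by
    intro a b hab
    rcases hab.eq_or_lt with rfl | h
    · exact le_rfl
    · exact (classPerm_lt (fun _ => c) σ rfl h).le
  exact (Equiv.Perm.monotone_iff _).1 h

lemma card_filter_mod_eq {L : ℕ} (hL : 0 < L) {c : ℕ} (hc : c < L) {x : ℕ} (hx : x ≤ n) :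
    x / L ≤ (Finset.univ.filter fun a : Fin n => (a : ℕ) % L = c ∧ (a : ℕ) < x).card ∧
    (Finset.univ.filter fun a : Fin n => (a : ℕ) % L = c ∧ (a : ℕ) < x).card ≤ x / L + 1 := by
  have h : (Finset.univ.filter fun a : Fin n => (a : ℕ) % L = c ∧ (a : ℕ) < x).card =
      Nat.count (fun a => a ≡ c [MOD L]) x := by
    rw [Nat.count_eq_card_filter_range]
    refine Finset.card_bij (fun a _ => (a : ℕ)) ?_ (fun a _ b _ h => Fin.ext h) ?_
    · intro a ha
      simp only [Finset.mem_filter, Finset.mem_univ, true_and] at ha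
      simp only [Finset.mem_filter, Finset.mem_range, Nat.ModEq, Nat.mod_eq_of_lt hc]
      exact ⟨ha.2, ha.1⟩
    · intro b hb
      simp only [Finset.mem_filter, Finset.mem_range, Nat.ModEq, Nat.mod_eq_of_lt hc] at hb
      exact ⟨⟨b, hb.1.trans_le hx⟩, by simpa using ⟨hb.2, hb.1⟩, rfl⟩
  rw [h, Nat.count_modEq_card _ hL]
  split_ifs <;> omega

/-- There are classes of bounded size such that sorting a random permutation inside the classes
moves few elements far. -/
lemma exists_classes (n : ℕ) {s : ℕ} (hs : 0 < s) :
    ∃ cl : Fin n → ℕ, (∀ c, (Finset.univ.filter fun a => cl a = c).card ≤ (2 * s) ^ 2) ∧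
      𝔼 σ : Equiv.Perm (Fin n), (displacement (classPerm cl σ) : ℝ) ≤ 2 * n ^ 2 / s := by
  have hs' : (1 : ℝ) ≤ s := by exact_mod_cast hs
  rcases lt_or_ge n (2 * s ^ 2) with hn | hn
  -- For small `n` a single class suffices: sorting everything gives the identity.
  · refine ⟨fun _ => 0, fun c => (Finset.card_le_univ _).trans ?_, ?_⟩
    · rw [Fintype.card_fin]
      nlinarith
    · simp only [classPerm_eq_one_of_const, displacement_one]
      rw [Nat.cast_zero, Finset.expect_const_zero]
      positivity
  -- Residue classes modulo `n / m` have between about `m` and `2 * m = (2 * s) ^ 2` elements.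
  · set m := 2 * s ^ 2 with hm
    have hm0 : 0 < m := by positivity
    set L := n / m with hLdef
    have hL : 0 < L := Nat.div_pos hn hm0
    have hLn : L * m ≤ n := Nat.div_mul_le_self n m
    have hnL : n / L + 1 ≤ 2 * m := by
      have h1 : n < m * (L + 1) := Nat.lt_mul_div_succ n hm0
      have h2 : n / L < 2 * m := Nat.div_lt_of_lt_mul (by nlinarith)
      omega
    have hcardn : ∀ c < L, n / L ≤ (Finset.univ.filter fun a : Fin n => (a : ℕ) % L = c).card ∧
        (Finset.univ.filter fun a : Fin n => (a : ℕ) % L = c).card ≤ n / L + 1 := by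
      intro c hc
      simpa using card_filter_mod_eq hL hc (le_refl n)
    have hclass : ∀ c, (Finset.univ.filter fun a : Fin n => (a : ℕ) % L = c).card ≤
        (2 * s) ^ 2 := by
      intro c
      rcases lt_or_ge c L with hc | hc
      · refine (hcardn c hc).2.trans (hnL.trans ?_)
        rw [hm]
        nlinarith
      · rw [Finset.filter_false_of_mem fun a _ => ((Nat.mod_lt _ hL).trans_le hc).ne]
        simp
    refine ⟨fun a => a % L, hclass, ?_⟩
    refine (expect_displacement_classPerm_le _ (fun a => Nat.mod_lt _ hL) (s := 2 * s) (by omega)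
      hclass ?_).trans ?_
    -- Both the count below `x` and the class size times `x / n` differ from `x / L` by at most one,
    -- whence the 2.
    · intro x hx c hc
      have h1 := card_filter_mod_eq hL hc hx
      have h2 := hcardn c hc
      have hLr : (0 : ℝ) < L := by exact_mod_cast hL
      have hn0 : (0 : ℝ) < n := by exact_mod_cast hm0.trans_le hn
      have hfloor : ∀ y : ℕ, (y : ℝ) / L - 1 ≤ (y / L : ℕ) ∧ ((y / L : ℕ) : ℝ) ≤ y / L := by
        intro y
        refine ⟨?_, Nat.cast_div_le⟩
        have h3 : y < L * (y / L + 1) := Nat.lt_mul_div_succ y hL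
        have h4 : (y : ℝ) < L * ((y / L : ℕ) + 1) := by exact_mod_cast h3
        have h5 : (y : ℝ) / L < (y / L : ℕ) + 1 := (div_lt_iff₀' hLr).2 h4
        linarith
      have hxn : (x : ℝ) / n ≤ 1 := (div_le_one hn0).2 (by exact_mod_cast hx)
      have hxn0 : 0 ≤ (x : ℝ) / n := by positivity
      have hxL : (n : ℝ) / L * (x / n) = x / L := by field_simp
      have f1 := hfloor x
      have f2 := hfloor n
      generalize (Finset.univ.filter fun a : Fin n => (a : ℕ) % L = c ∧ (a : ℕ) < x).card = A at *
      generalize (Finset.univ.filter fun a : Fin n => (a : ℕ) % L = c).card = B at *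
      have a1 : ((x / L : ℕ) : ℝ) ≤ A := by exact_mod_cast h1.1
      have a2 : (A : ℝ) ≤ (x / L : ℕ) + 1 := by exact_mod_cast h1.2
      have b1 : ((n / L : ℕ) : ℝ) ≤ B := by exact_mod_cast h2.1
      have b2 : (B : ℝ) ≤ (n / L : ℕ) + 1 := by exact_mod_cast h2.2
      have c1 : (B : ℝ) * (x / n) ≤ x / L + 1 := by
        rw [← hxL]
        nlinarith
      have c2 : (x : ℝ) / L - 1 ≤ B * (x / n) := by
        rw [← hxL]
        nlinarith
      rw [abs_le]
      constructor <;> linarith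
    · have h1 : (L : ℝ) * (2 * s ^ 2) ≤ n := by
        have : (L : ℝ) * (m : ℕ) ≤ n := by exact_mod_cast hLn
        rw [hm] at this
        push_cast at this
        exact this
      rw [le_div_iff₀ (by linarith)]
      push_cast
      have h2 : (L : ℝ) * (2 + 2 * s) * s ≤ 2 * n := by
        have hLr : (0 : ℝ) ≤ L := Nat.cast_nonneg L
        nlinarith [mul_nonneg hLr (mul_nonneg (sub_nonneg.2 hs') (zero_le_one.trans hs'))]
      have hn0 : (0 : ℝ) ≤ n := Nat.cast_nonneg n
      nlinarith [mul_le_mul_of_nonneg_left h2 hn0]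

end ClassSort

/-! ### Canonical simulation of query algorithms on sorted random permutations -/

section Simulation

variable {K : OrdKind} {α : Type*} {m n q : ℕ}

/-- The rearrangement of an injection that is increasing on each class. -/
def sortEmb (cl : Fin m → ℕ) (φ : Fin m ↪ Fin n) : Fin m ↪ Fin n :=
  (classSort cl φ).toEmbedding.trans φ

lemma strictMonoOn_sortEmb (cl : Fin m → ℕ) (φ : Fin m ↪ Fin n) (c : ℕ) :
    StrictMonoOn (sortEmb cl φ) {a | cl a = c} := fun _ ha _ hb hab =>
  comp_classSort_lt cl φ.injective (Eq.trans ha (Eq.symm hb)) hab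

lemma image_sortEmb (cl : Fin m → ℕ) (φ : Fin m ↪ Fin n) (c : ℕ) :
    sortEmb cl φ '' {a | cl a = c} = φ '' {a | cl a = c} :=
  image_comp_classSort cl φ c

/-- An increasing `s` commutes with sorting, so the sorted injection can be computed from the
reading order `τ` alone, without knowing where the sample lies in `[n]`. -/
lemma sortEmb_trans_orderEmb (cl : Fin m → ℕ) (τ : Equiv.Perm (Fin m)) (s : Fin m ↪o Fin n)
    (a : Fin m) :
    sortEmb cl (τ.toEmbedding.trans s.toEmbedding) a = s (classPerm cl τ a) := by
  refine eq_of_strictMonoOn_of_image_eq (C := {b | cl b = cl a}) (strictMonoOn_sortEmb cl _ _)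
    (h := fun a => s (classPerm cl τ a))
    (fun b hb b' hb' h => s.strictMono (classPerm_lt cl τ (Eq.trans hb (Eq.symm hb')) h)) ?_ rfl
  rw [image_sortEmb]
  have h := image_comp_classSort cl τ (cl a)
  change _ = (s ∘ (τ ∘ classSort cl τ)) '' _
  rw [Set.image_comp, h, ← Set.image_comp]
  rfl

/-- If `w` contains the whole class of `w a`, sorting inside the range of `w` or inside `[n]` gives
the same result: an increasing map on the class is determined by its image. -/
lemma sortEmb_trans_perm (cl : Fin n → ℕ) (w : Fin m ↪o Fin n) (σ : Equiv.Perm (Fin n)) (a : Fin m)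
    (hw : ∀ b, cl b = cl (w a) → b ∈ Set.range w) :
    sortEmb (cl ∘ w) (w.toEmbedding.trans σ.toEmbedding) a = classPerm cl σ (w a) := by
  refine eq_of_strictMonoOn_of_image_eq (C := {b | (cl ∘ w) b = cl (w a)})
    (strictMonoOn_sortEmb (cl ∘ w) _ _) (h := fun a => classPerm cl σ (w a))
    (fun b hb b' hb' h => classPerm_lt cl σ (Eq.trans hb (Eq.symm hb')) (w.strictMono h)) ?_ rfl
  have hC : w '' {b | (cl ∘ w) b = cl (w a)} = {b | cl b = cl (w a)} := by
    ext b
    constructor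
    · rintro ⟨b, hb, rfl⟩
      exact hb
    · intro hb
      obtain ⟨b, rfl⟩ := hw b hb
      exact ⟨b, hb, rfl⟩
  rw [image_sortEmb]
  change (σ ∘ w) '' _ = (classPerm cl σ ∘ w) '' _
  rw [Set.image_comp, Set.image_comp, hC]
  exact (image_comp_classSort cl σ _).symm

lemma expect_mem_Icc {ι : Type*} [Fintype ι] (d : ι → Set.Icc (0 : ℝ) 1) :
    (𝔼 i, (d i : ℝ)) ∈ Set.Icc (0 : ℝ) 1 := by
  refine ⟨Finset.expect_nonneg fun i _ => (d i).2.1, ?_⟩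
  rw [Fintype.expect_eq_sum_div_card]
  refine div_le_one_of_le₀ ?_ (Nat.cast_nonneg _)
  calc ∑ i, (d i : ℝ) ≤ ∑ _i : ι, (1 : ℝ) := Finset.sum_le_sum fun i _ => (d i).2.2
    _ = _ := by simp

/-- Deciding on a fixed query set after sorting a random permutation inside small classes can be
simulated by looking at a uniformly random sample. -/
lemma exists_decision_of_classPerm (cl : Fin n → ℕ) {c Q : ℕ}
    (hcl : ∀ i, (Finset.univ.filter fun a => cl a = i).card ≤ c) (hQ : 2 * q * c ≤ Q)
    (S : Finset (Entry K n)) (hS : S.card ≤ q) (dec : (S → α) → Set.Icc (0 : ℝ) 1) :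
    ∃ D : Obj K α (min Q n) → Set.Icc (0 : ℝ) 1, ∀ f : Obj K α n,
      𝔼 σ : Axis K → Equiv.Perm (Fin n),
        (dec fun e => f (permute (fun x => classPerm cl (σ x)) e.1) : ℝ) =
      𝔼 s, (D (restrict f s) : ℝ) := by
  classical
  let U : Finset (Fin n) := S.biUnion verts
  have hU : U.card ≤ 2 * q := by
    refine (Finset.card_biUnion_le_card_mul S verts 2 fun e _ => card_verts_le e).trans ?_
    omega
  -- Whole classes are included, since sorting at a queried vertex needs `σ` on its entire class.
  let V : Finset (Fin n) := U.biUnion fun u => Finset.univ.filter fun a => cl a = cl u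
  have hV : V.card ≤ min Q n := by
    refine le_min ?_ ((Finset.card_le_univ V).trans (by simp))
    exact (Finset.card_biUnion_le_card_mul U _ c fun u _ => hcl _).trans
      ((Nat.mul_le_mul_right c hU).trans hQ)
  obtain ⟨W, hVW, hW⟩ := Finset.exists_superset_card_eq hV (by simp)
  let w : Fin (min Q n) ↪o Fin n := W.orderEmbOfFin hW
  have hrange : ∀ a, a ∈ Set.range w ↔ a ∈ W := fun a => by
    simp [w, Finset.range_orderEmbOfFin]
  have hclass : ∀ e ∈ S, ∀ u ∈ verts e, ∀ b, cl b = cl u → b ∈ Set.range w := by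
    intro e he u hu b hb
    rw [hrange]
    refine hVW (Finset.mem_biUnion.2 ⟨u, Finset.mem_biUnion.2 ⟨e, he, hu⟩, ?_⟩)
    simpa using hb
  have hex : ∀ e : S, ∃ e' : Entry K (min Q n), pull (fun _ => w.toEmbedding) e' = e.1 :=
    fun e => exists_pull_eq w.toEmbedding e.1 fun a ha => hclass e.1 e.2 a ha a rfl
  choose r hr using hex
  -- The reading order `τ` is simulated by averaging; everything else is visible in the sample.
  refine ⟨fun H => ⟨𝔼 τ : Axis K → Equiv.Perm (Fin (min Q n)),
    (dec fun e => H (permute (fun x => classPerm (cl ∘ w) (τ x)) (r e)) : ℝ),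
    expect_mem_Icc _⟩, fun f => ?_⟩
  have h1 : ∀ σ : Axis K → Equiv.Perm (Fin n),
      (fun e : S => f (permute (fun x => classPerm cl (σ x)) e.1)) = fun e : S =>
        f (pull (fun x => sortEmb (cl ∘ w) (w.toEmbedding.trans (σ x).toEmbedding)) (r e)) := by
    intro σ
    funext e
    conv_lhs => rw [← hr e]
    rw [permute, pull_pull]
    refine congrArg f (pull_congr fun x a ha => ?_)
    refine (sortEmb_trans_perm cl w (σ x) a fun b hb => hclass e.1 e.2 (w a) ?_ b hb).symm
    rw [← hr e, verts_pull]
    exact Finset.mem_map_of_mem _ ha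
  have h2 : ∀ (s : Sample K (min Q n) n) (τ : Axis K → Equiv.Perm (Fin (min Q n))),
      (fun e : S => f (pull (fun x => sortEmb (cl ∘ w) (sampleEmb s τ x)) (r e))) =
        fun e : S => restrict f s (permute (fun x => classPerm (cl ∘ w) (τ x)) (r e)) := by
    intro s τ
    funext e
    rw [restrict_eq]
    dsimp only
    rw [samplePull, permute, pull_pull]
    exact congrArg f (pull_congr fun x a _ => sortEmb_trans_orderEmb _ _ _ _)
  simp only [h1]
  rw [expect_perm_trans_eq_expect_sample w.toEmbedding fun φ =>
    (dec fun e => f (pull (fun x => sortEmb (cl ∘ w) (φ x)) (r e)) : ℝ)]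
  simp only [h2]

lemma exists_canonicalAlgorithm_of_classPerm (cl : Fin n → ℕ) {c Q : ℕ}
    (hcl : ∀ i, (Finset.univ.filter fun a => cl a = i).card ≤ c) (hQ : 2 * q * c ≤ Q)
    (T : QueryAlgorithm (Entry K n) α q) :
    ∃ T' : CanonicalAlgorithm K α Q n, ∀ f, T'.acceptProb f =
      𝔼 σ : Axis K → Equiv.Perm (Fin n),
        T.acceptProb fun e => f (permute (fun x => classPerm cl (σ x)) e) := by
  classical
  let w : Finset (Entry K n) → ℝ := fun S => (T.queries S).toReal
  have hw : ∀ S, 0 ≤ w S := fun S => ENNReal.toReal_nonneg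
  have hw1 : ∑ S, w S = 1 := sum_toReal_pmf T.queries
  have hD : ∀ S, ∃ D : Obj K α (min Q n) → Set.Icc (0 : ℝ) 1, ∀ f : Obj K α n,
      w S * 𝔼 σ : Axis K → Equiv.Perm (Fin n),
        (T.decision S fun e => f (permute (fun x => classPerm cl (σ x)) e.1) : ℝ) =
      w S * 𝔼 s, (D (restrict f s) : ℝ) := by
    intro S
    by_cases hS : S ∈ T.queries.support
    · obtain ⟨D, hD⟩ := exists_decision_of_classPerm (α := α) cl hcl hQ S (T.card_le S hS)
        (T.decision S)
      exact ⟨D, fun f => by rw [hD f]⟩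
    -- Query sets outside the support may be too large to simulate, but carry no weight.
    · have h0 : w S = 0 := by
        simp only [w, (PMF.apply_eq_zero_iff _ _).2 hS, ENNReal.toReal_zero]
      exact ⟨fun _ => ⟨0, by norm_num⟩, fun f => by rw [h0, zero_mul, zero_mul]⟩
  choose D hD using hD
  refine ⟨⟨fun H => ⟨∑ S, w S * (D S H : ℝ),
    Finset.sum_nonneg fun S _ => mul_nonneg (hw S) (D S H).2.1, ?_⟩⟩, fun f => ?_⟩
  · exact (Finset.sum_le_sum fun S _ =>
      mul_le_of_le_one_right (hw S) (D S H).2.2).trans hw1.le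
  · rw [CanonicalAlgorithm.acceptProb_eq_expect]
    simp only [QueryAlgorithm.acceptProb]
    rw [Finset.expect_sum_comm, Finset.expect_sum_comm]
    refine Finset.sum_congr rfl fun S _ => ?_
    rw [← Finset.mul_expect, ← Finset.mul_expect]
    exact (hD S f).symm

end Simulation

/-! ### Closure properties of polynomial bounds -/

section Poly

variable {g h : ℝ → ℝ}

lemma PolyBounded.exists_nonneg (hg : PolyBounded g) :
    ∃ C : ℝ, 0 ≤ C ∧ ∃ k : ℕ, ∀ ε ∈ Set.Ioo (0 : ℝ) 1, g ε ≤ C * (1 / ε) ^ k := by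
  obtain ⟨C, k, hC⟩ := hg
  refine ⟨|C|, abs_nonneg C, k, fun ε hε => (hC ε hε).trans ?_⟩
  have : 0 ≤ (1 / ε) ^ k := by
    have := hε.1
    positivity
  exact mul_le_mul_of_nonneg_right (le_abs_self C) this

lemma PolyBounded.of_le (hh : PolyBounded h) (hle : ∀ ε ∈ Set.Ioo (0 : ℝ) 1, g ε ≤ h ε) :
    PolyBounded g := by
  obtain ⟨C, k, hC⟩ := hh
  exact ⟨C, k, fun ε hε => (hle ε hε).trans (hC ε hε)⟩

lemma polyBounded_const (c : ℝ) : PolyBounded fun _ => c :=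
  ⟨c, 0, fun ε _ => by simp⟩

lemma polyBounded_one_div : PolyBounded fun ε => 1 / ε :=
  ⟨1, 1, fun ε _ => by simp⟩

lemma PolyBounded.mul (hg : PolyBounded g) (hh : PolyBounded h)
    (hh0 : ∀ ε ∈ Set.Ioo (0 : ℝ) 1, 0 ≤ h ε) : PolyBounded fun ε => g ε * h ε := by
  obtain ⟨C, hC0, k, hC⟩ := hg.exists_nonneg
  obtain ⟨D, -, l, hD⟩ := hh.exists_nonneg
  refine ⟨C * D, k + l, fun ε hε => ?_⟩
  have h0 := hε.1
  calc g ε * h ε ≤ (C * (1 / ε) ^ k) * (D * (1 / ε) ^ l) :=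
        mul_le_mul (hC ε hε) (hD ε hε) (hh0 ε hε) (by positivity)
    _ = C * D * (1 / ε) ^ (k + l) := by ring

lemma PolyBounded.add (hg : PolyBounded g) (hh : PolyBounded h) :
    PolyBounded fun ε => g ε + h ε := by
  obtain ⟨C, hC0, k, hC⟩ := hg.exists_nonneg
  obtain ⟨D, hD0, l, hD⟩ := hh.exists_nonneg
  refine ⟨C + D, k + l, fun ε hε => ?_⟩
  have h1 : 1 ≤ 1 / ε := (one_le_div hε.1).2 hε.2.le
  calc g ε + h ε ≤ C * (1 / ε) ^ k + D * (1 / ε) ^ l := add_le_add (hC ε hε) (hD ε hε)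
    _ ≤ C * (1 / ε) ^ (k + l) + D * (1 / ε) ^ (k + l) := by
        gcongr <;> first | exact h1 | omega
    _ = _ := by ring

lemma PolyBounded.comp (hg : PolyBounded g) {u : ℝ → ℝ}
    (hu : ∀ ε ∈ Set.Ioo (0 : ℝ) 1, u ε ∈ Set.Ioo (0 : ℝ) 1) (hu' : PolyBounded fun ε => 1 / u ε) :
    PolyBounded fun ε => g (u ε) := by
  obtain ⟨C, hC0, k, hC⟩ := hg.exists_nonneg
  obtain ⟨D, -, l, hD⟩ := hu'.exists_nonneg
  refine ⟨C * D ^ k, l * k, fun ε hε => (hC _ (hu ε hε)).trans ?_⟩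
  have h0 := (hu ε hε).1
  calc C * (1 / u ε) ^ k ≤ C * (D * (1 / ε) ^ l) ^ k := by
        gcongr
        exact hD ε hε
    _ = C * D ^ k * (1 / ε) ^ (l * k) := by rw [mul_pow, ← pow_mul]; ring

end Poly

/-! ### From canonical tests to resilience and tolerant tests -/

section FromCanonical

variable {K : OrdKind} {α : Type*} {n : ℕ}

lemma canonicalDelta_pos (q : ℝ → ℕ) (ε : ℝ) : 0 < canonicalDelta q ε := by
  have : 0 < max 1 ((q ε).choose 2) := lt_max_of_lt_left one_pos
  unfold canonicalDelta
  positivity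

lemma canonicalDelta_lt_one (q : ℝ → ℕ) (ε : ℝ) : canonicalDelta q ε < 1 := by
  have h : (1 : ℝ) ≤ (max 1 ((q ε).choose 2) : ℕ) := by exact_mod_cast le_max_left _ _
  unfold canonicalDelta
  rw [div_lt_one (by positivity)]
  linarith

lemma mul_canonicalDelta_le (q : ℝ → ℕ) (ε : ℝ) {a c : ℕ}
    (h : a ≤ c * max 1 ((q ε).choose 2)) : (a : ℝ) * canonicalDelta q ε ≤ c / 20 := by
  have h1 : (0 : ℝ) < (max 1 ((q ε).choose 2) : ℕ) := by
    exact_mod_cast lt_max_of_lt_left one_pos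
  have h2 : (a : ℝ) ≤ c * (max 1 ((q ε).choose 2) : ℕ) := by exact_mod_cast h
  unfold canonicalDelta
  rw [mul_one_div, div_le_div_iff₀ (by positivity) (by norm_num)]
  linarith

/-- The factor 4 serves images: `q ^ 2 ≤ 2 * q * (q - 1)` once `q ≥ 2`. -/
lemma card_entry_min_le (K : OrdKind) (q n : ℕ) :
    Fintype.card (Entry K (min q n)) ≤ 4 * max 1 (q.choose 2) := by
  cases K
  · calc Fintype.card (Pair (min q n)) = (min q n).choose 2 := card_pair _
      _ ≤ q.choose 2 := Nat.choose_le_choose 2 (min_le_left q n)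
      _ ≤ max 1 (q.choose 2) := le_max_right _ _
      _ ≤ _ := by omega
  · have h1 : Fintype.card (Fin (min q n) × Fin (min q n)) ≤ q * q := by
      rw [Fintype.card_prod, Fintype.card_fin]
      exact Nat.mul_le_mul (min_le_left q n) (min_le_left q n)
    refine h1.trans ?_
    rcases q with _ | _ | q
    · simp
    · simp
    · have h2 : (q + 2).choose 2 * 2 = (q + 2) * (q + 1) := by
        rw [Nat.choose_two_right, Nat.div_mul_cancel (Nat.even_mul_pred_self _).two_dvd]
        rfl
      have h3 := le_max_right 1 ((q + 2).choose 2)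
      nlinarith

/-- The normalizations for images are comparable only from `n = 2` on; for `n ≤ 1` there are no
basic moves at all. -/
lemma choose_numBase_le (K : OrdKind) (n : ℕ) :
    ((numBase K n).choose 2 : ℝ) ≤ 6 * (n.choose 2 : ℕ) ∨ n ≤ 1 := by
  rcases le_or_gt n 1 with h | h
  · exact Or.inr h
  · left
    have hn : (2 : ℝ) ≤ n := by exact_mod_cast h
    cases K
    · change ((n.choose 2 : ℕ) : ℝ) ≤ _
      have : (0 : ℝ) ≤ (n.choose 2 : ℕ) := Nat.cast_nonneg _
      linarith
    · change (((2 * n).choose 2 : ℕ) : ℝ) ≤ _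
      rw [Nat.cast_choose_two, Nat.cast_choose_two]
      push_cast
      nlinarith

lemma movesIn_eq_of_le_one {α : Type*} {k : ℕ} {f f' : Obj K α n} (hn : n ≤ 1)
    (h : MovesIn k f f') : f' = f := by
  cases h with
  | zero => rfl
  | succ _ hb =>
    obtain ⟨_, i, j, hij, -⟩ := (basicMove_iff _ _).1 hb
    have := j.2
    omega

/-- Within the allowed distance the acceptance probability changes by at most `6 / 20`, less than
the gap of `1 / 3` between members and far structures. -/
theorem resilientWith_canonicalDelta [DecidableEq α] {P : Property K α} {q : ℝ → ℕ}
    (hP : CanonicallyTestableWith P q) : ResilientWith P (canonicalDelta q) := by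
  intro ε hε n f f' hf hd
  obtain ⟨T, hT1, hT2⟩ := hP ε hε n
  obtain ⟨k, hk, hkle⟩ := exists_movesIn_of_earthmover_le (canonicalDelta_pos q ε).le hd
  by_contra hcon
  have h1 := hT1 f hf
  have h2 := hT2 f' hcon
  have h3 := (abs_le.1 (T.abs_acceptProb_sub_le_of_movesIn hk)).1
  rcases choose_numBase_le K n with hn | hn
  · have h4 : (k : ℝ) * (((min (q ε) n).choose 2 : ℕ) / (n.choose 2 : ℕ)) ≤ 6 / 20 := by
      have hδ := (canonicalDelta_pos q ε).le
      rcases (Nat.cast_nonneg (n.choose 2) : (0 : ℝ) ≤ _).eq_or_lt with h0 | h0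
      · rw [← h0, div_zero, mul_zero]
        norm_num
      · rw [mul_div_assoc', div_le_iff₀ h0]
        have h5 : (min (q ε) n).choose 2 ≤ 1 * max 1 ((q ε).choose 2) := by
          rw [one_mul]
          exact (Nat.choose_le_choose 2 (min_le_left _ n)).trans (le_max_right _ _)
        have h6 := mul_canonicalDelta_le q ε h5
        calc (k : ℝ) * ((min (q ε) n).choose 2 : ℕ)
            ≤ canonicalDelta q ε * ((numBase K n).choose 2 : ℕ) *
              ((min (q ε) n).choose 2 : ℕ) := by gcongr
          _ ≤ canonicalDelta q ε * (6 * (n.choose 2 : ℕ)) * ((min (q ε) n).choose 2 : ℕ) := by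
              gcongr
          _ = ((min (q ε) n).choose 2 : ℕ) * canonicalDelta q ε * (6 * (n.choose 2 : ℕ)) := by ring
          _ ≤ ((1 : ℕ) / 20) * (6 * (n.choose 2 : ℕ)) := by gcongr
          _ = _ := by push_cast; ring
    linarith
  · rw [movesIn_eq_of_le_one hn hk] at h2
    linarith

lemma CanonicalAlgorithm.exists_queryAlgorithm {q Q : ℕ} (T : CanonicalAlgorithm K α q n)
    (hQ : Fintype.card (Entry K (min q n)) ≤ Q) :
    ∃ T' : QueryAlgorithm (Entry K n) α Q, ∀ f, T'.acceptProb f = T.acceptProb f := by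
  classical
  obtain ⟨T', hT'⟩ := OrdKind.exists_queryAlgorithm (α := α) (q := Q)
    (PMF.uniformOfFintype (Sample K (min q n) n))
    (fun s => Finset.univ.image (samplePull (sampleEquiv K _ n s)))
    (fun s _ => Finset.card_image_le.trans hQ)
    (fun s v => T.decision fun e => v ⟨samplePull (sampleEquiv K _ n s) e,
      Finset.mem_image_of_mem _ (Finset.mem_univ e)⟩)
  refine ⟨T', fun f => ?_⟩
  rw [hT', CanonicalAlgorithm.acceptProb, Finset.sum_div]
  refine Finset.sum_congr rfl fun s _ => ?_
  rw [restrict_eq, PMF.uniformOfFintype_apply, ENNReal.toReal_inv, ENNReal.toReal_natCast,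
    div_eq_inv_mul]

lemma CloseTo.mono [DecidableEq α] {S : Set (Obj K α n)} {ε ε' : ℝ} {f : Obj K α n}
    (h : CloseTo S ε f) (hle : ε ≤ ε') : CloseTo S ε' f :=
  let ⟨g, hg, hfg⟩ := h
  ⟨g, hg, hfg.trans hle⟩

theorem tolerantlyTestableWith_canonicalDelta [DecidableEq α] {P : Property K α} {q : ℝ → ℕ}
    (hP : CanonicallyTestableWith P q) :
    TolerantlyTestableWith P (canonicalDelta q)
      fun ε => 675 * (4 * max 1 ((q ε).choose 2)) := by
  intro ε hε n
  obtain ⟨T, hT1, hT2⟩ := hP ε hε n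
  obtain ⟨T₁, hT₁⟩ := T.exists_queryAlgorithm (card_entry_min_le K (q ε) n)
  -- Close structures are accepted with probability at least `2/3 - 4/20 = 7/15`, far ones at most
  -- `1/3`: the threshold `2/5` is `1/15` from both, and `675 / 15 ^ 2 = 3` gives error `1/3`.
  obtain ⟨T₂, hT₂⟩ := T₁.exists_amplification (r := 675) (by norm_num) (t := 1 / 15)
    (by norm_num) (2 / 5)
  refine ⟨T₂, fun f hf => ?_, fun f hf => ?_⟩
  · obtain ⟨g, hg, hfg⟩ := hf
    have h1 := hT1 g hg
    have h2 := (abs_le.1 (T.abs_acceptProb_sub_le_relHamming f g)).1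
    have h3 : (Fintype.card (Entry K (min (q ε) n)) : ℝ) * relHamming f g ≤ (4 : ℕ) / 20 :=
      (mul_le_mul_of_nonneg_left hfg (Nat.cast_nonneg _)).trans
        (mul_canonicalDelta_le q ε (card_entry_min_le K (q ε) n))
    have h4 := (hT₂ f).1 (by rw [hT₁]; push_cast at h3; linarith)
    norm_num at h4
    linarith
  · have h1 := hT2 f hf
    have h2 := (hT₂ f).2 (by rw [hT₁]; linarith)
    norm_num at h2
    linarith

lemma TolerantlyTestableWith.mono [DecidableEq α] {P : Property K α} {q : ℝ → ℕ} {η η' : ℝ → ℝ}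
    (h : TolerantlyTestableWith P η q) (hle : ∀ ε, η' ε ≤ η ε) :
    TolerantlyTestableWith P η' q := fun ε hε n =>
  let ⟨T, hT1, hT2⟩ := h ε hε n
  ⟨T, fun f hf => hT1 f (hf.mono (hle ε)), hT2⟩

lemma polyBounded_one_div_canonicalDelta {q : ℝ → ℕ} (hq : PolyBounded fun ε => (q ε : ℝ)) :
    PolyBounded fun ε => 1 / canonicalDelta q ε := by
  have hq0 : ∀ ε ∈ Set.Ioo (0 : ℝ) 1, (0 : ℝ) ≤ q ε := fun ε _ => Nat.cast_nonneg _
  refine ((polyBounded_const 20).add ((polyBounded_const 20).mul (hq.mul hq hq0)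
    fun ε _ => mul_self_nonneg _)).of_le fun ε _ => ?_
  have h1 : max 1 ((q ε).choose 2) ≤ 1 + q ε * q ε := by
    refine max_le (by omega) ?_
    have := Nat.choose_le_pow (q ε) 2
    nlinarith
  have h2 : ((max 1 ((q ε).choose 2) : ℕ) : ℝ) ≤ 1 + q ε * q ε := by exact_mod_cast h1
  unfold canonicalDelta
  rw [one_div_one_div]
  linarith

lemma polyBounded_one_div_min {u v : ℝ → ℝ} (hu0 : ∀ ε ∈ Set.Ioo (0 : ℝ) 1, 0 < u ε)
    (hv0 : ∀ ε ∈ Set.Ioo (0 : ℝ) 1, 0 < v ε) (hu : PolyBounded fun ε => 1 / u ε)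
    (hv : PolyBounded fun ε => 1 / v ε) : PolyBounded fun ε => 1 / min (u ε) (v ε) := by
  refine (hu.add hv).of_le fun ε hε => ?_
  have h1 := one_div_pos.2 (hu0 ε hε)
  have h2 := one_div_pos.2 (hv0 ε hε)
  rcases min_choice (u ε) (v ε) with h | h <;> rw [h] <;> linarith

lemma polyBounded_one_div_half : PolyBounded fun ε => 1 / (ε / 2) :=
  ((polyBounded_const 2).mul polyBounded_one_div fun ε hε => (one_div_pos.2 hε.1).le).of_le
    fun ε _ => by rw [one_div_div]; exact (mul_one_div 2 ε).ge

end FromCanonical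

/-! ### From resilience and tolerant tests to canonical tests -/

section ToCanonical

variable {K : OrdKind} {α : Type*} {n : ℕ}

lemma relHamming_permute [DecidableEq α] (f g : Obj K α n) (σ : Axis K → Equiv.Perm (Fin n)) :
    relHamming (fun e => f (permute σ e)) (fun e => g (permute σ e)) = relHamming f g := by
  rw [relHamming_eq_expect, relHamming_eq_expect]
  exact Fintype.expect_equiv (permuteEquiv σ) _ _ fun _ => rfl

lemma relHamming_triangle [DecidableEq α] (f g h : Obj K α n) :
    relHamming f h ≤ relHamming f g + relHamming g h := by
  unfold relHamming
  rw [← add_div]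
  gcongr
  exact_mod_cast hammingDist_triangle f g h

lemma earthmover_permute_le (f : Obj K α n) (σ : Axis K → Equiv.Perm (Fin n)) {δ : ℝ}
    (hδ : 0 ≤ δ)
    (h : ((∑ x, displacement (σ x) : ℕ) : ℝ) ≤ δ * ((numBase K n).choose 2 : ℕ)) :
    earthmover f (fun e => f (permute σ e)) ≤ ENNReal.ofReal δ := by
  obtain ⟨k, hk, hm⟩ := exists_movesIn_permute f σ
  exact earthmover_le_of_movesIn hm (le_trans (by exact_mod_cast hk) h) hδ

/-- Undo the rearrangement on the nearby member `g`: the inverse has the same displacement, so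
resilience applies to `g`, and Hamming distance is invariant under simultaneous rearrangement. -/
lemma closeTo_of_closeTo_permute [DecidableEq α] {P : Property K α} {δ : ℝ → ℝ}
    (hP : ResilientWith P δ) {ε ε' : ℝ} (hε : ε ∈ Set.Ioo (0 : ℝ) 1) (f : Obj K α n)
    (σ : Axis K → Equiv.Perm (Fin n)) (hδ : 0 ≤ δ ε)
    (h : ((∑ x, displacement (σ x) : ℕ) : ℝ) ≤ δ ε * ((numBase K n).choose 2 : ℕ))
    (hclose : CloseTo (P n) ε' (fun e => f (permute σ e))) : CloseTo (P n) (ε' + ε) f := by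
  obtain ⟨g, hg, hfg⟩ := hclose
  have h1 : earthmover g (fun e => g (permute σ⁻¹ e)) ≤ ENNReal.ofReal (δ ε) := by
    refine earthmover_permute_le g σ⁻¹ hδ ?_
    simpa [displacement_inv] using h
  obtain ⟨g', hg', hgg'⟩ := hP ε hε n g _ hg h1
  refine ⟨g', hg', (relHamming_triangle f (fun e => g (permute σ⁻¹ e)) g').trans
    (add_le_add ?_ hgg')⟩
  rw [← relHamming_permute f _ σ]
  simpa only [← permute_mul, inv_mul_cancel, permute_one] using hfg

lemma card_axis_mul (K : OrdKind) (n : ℕ) : Fintype.card (Axis K) * n = numBase K n := by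
  cases K
  · exact one_mul n
  · rfl

lemma expect_apply_axis (x : Axis K) (h : Equiv.Perm (Fin n) → ℝ) :
    𝔼 σ : Axis K → Equiv.Perm (Fin n), h (σ x) = 𝔼 ρ, h ρ := by
  have := expect_act (G := Axis K → Equiv.Perm (Fin n)) (fun σ => Equiv.mulLeft (σ x))
    (fun ρ ρ' => ⟨fun _ => ρ' * ρ⁻¹, fun g => by simp⟩) h 1
  simpa using this

lemma expect_sum_displacement_le {cl : Fin n → ℕ} {s : ℕ}
    (hcl : 𝔼 σ : Equiv.Perm (Fin n), (displacement (classPerm cl σ) : ℝ) ≤ 2 * n ^ 2 / s) :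
    𝔼 σ : Axis K → Equiv.Perm (Fin n),
      ((∑ x, displacement (classPerm cl (σ x)) : ℕ) : ℝ) ≤
        8 * ((numBase K n).choose 2 : ℕ) / s := by
  rcases le_or_gt n 1 with hn | hn
  · have : Subsingleton (Fin n) := Fin.subsingleton_iff_le_one.2 hn
    have h0 : ∀ π : Equiv.Perm (Fin n), displacement π = 0 := fun π => by
      rw [Subsingleton.elim π 1, displacement_one]
    simp only [h0, Finset.sum_const_zero]
    rw [Nat.cast_zero, Finset.expect_const_zero]
    positivity
  · have hn' : (2 : ℝ) ≤ n := by exact_mod_cast hn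
    push_cast
    rw [Finset.expect_sum_comm]
    have h1 : ∀ x ∈ (Finset.univ : Finset (Axis K)), 𝔼 σ : Axis K → Equiv.Perm (Fin n),
        (displacement (classPerm cl (σ x)) : ℝ) ≤ 2 * n ^ 2 / (s : ℝ) := fun x _ => by
      rw [expect_apply_axis x fun ρ => (displacement (classPerm cl ρ) : ℝ)]
      exact hcl
    refine (Finset.sum_le_sum h1).trans ?_
    rw [Finset.sum_const, nsmul_eq_mul, mul_div_assoc', Finset.card_univ]
    refine div_le_div_of_nonneg_right ?_ (Nat.cast_nonneg s)
    have h2 : (Fintype.card (Axis K) : ℝ) * n = numBase K n := by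
      exact_mod_cast card_axis_mul K n
    have h3 : (2 : ℝ) ≤ numBase K n := by
      cases K
      · exact hn'
      · change (2 : ℝ) ≤ (2 * n : ℕ)
        push_cast
        linarith
    have h4 : (n : ℝ) ≤ numBase K n := by
      cases K
      · exact le_rfl
      · change (n : ℝ) ≤ (2 * n : ℕ)
        push_cast
        linarith
    rw [Nat.cast_choose_two]
    -- For `n ≥ 2`, with `b` base elements, `n ≤ b ≤ 2 * (b - 1)`.
    calc (Fintype.card (Axis K) : ℝ) * (2 * n ^ 2) = 2 * (numBase K n * n) := by rw [← h2]; ring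
      _ ≤ 8 * (numBase K n * (numBase K n - 1) / 2) := by nlinarith

open Classical in
-- Markov's inequality: the exceptional probability is at most `8 / (s * δ)`, and `s ≥ 160 / δ`
-- makes this `1 / 20`.
lemma exists_classes_of_le (K : OrdKind) (n : ℕ) {δ : ℝ} (hδ : 0 < δ) {s : ℕ}
    (hs : 160 / δ ≤ s) :
    ∃ cl : Fin n → ℕ, (∀ c, (Finset.univ.filter fun a => cl a = c).card ≤ (2 * s) ^ 2) ∧
      (𝔼 σ : Axis K → Equiv.Perm (Fin n),
        if ((∑ x, displacement (classPerm cl (σ x)) : ℕ) : ℝ) ≤ δ * ((numBase K n).choose 2 : ℕ)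
        then (0 : ℝ) else 1) ≤ 1 / 20 := by
  have hs0 : (0 : ℝ) < s := (div_pos (by norm_num) hδ).trans_le hs
  obtain ⟨cl, hcl, hdisp⟩ := exists_classes n (s := s) (by exact_mod_cast hs0)
  refine ⟨cl, hcl, ?_⟩
  have hE := expect_sum_displacement_le (K := K) hdisp
  set N := (numBase K n).choose 2
  rcases Nat.eq_zero_or_pos N with hN | hN
  · rw [hN] at hE ⊢
    simp only [Nat.cast_zero, mul_zero, zero_div] at hE ⊢
    -- With threshold zero the indicator is bounded by the displacement itself, an integer of
    -- expectation zero.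
    refine le_trans (Finset.expect_le_expect fun σ _ => ?_) (hE.trans (by norm_num))
    split_ifs with h
    · positivity
    · exact_mod_cast Nat.one_le_iff_ne_zero.2 fun h0 => h (by rw [h0, Nat.cast_zero])
  · have hN' : (0 : ℝ) < N := by exact_mod_cast hN
    have h1 : ∀ σ : Axis K → Equiv.Perm (Fin n),
        (if ((∑ x, displacement (classPerm cl (σ x)) : ℕ) : ℝ) ≤ δ * N then (0 : ℝ) else 1) ≤
          ((∑ x, displacement (classPerm cl (σ x)) : ℕ) : ℝ) / (δ * N) := by
      intro σ
      split_ifs with h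
      · positivity
      · rw [one_le_div (by positivity)]
        exact (not_le.1 h).le
    refine (Finset.expect_le_expect fun σ _ => h1 σ).trans ?_
    rw [← Finset.expect_div, div_le_iff₀ (by positivity)]
    refine hE.trans ?_
    rw [div_le_iff₀ hδ] at hs
    rw [div_le_iff₀ hs0]
    nlinarith

lemma QueryAlgorithm.acceptProb_mem_Icc {E : Type*} [Fintype E] {q : ℕ}
    (T : QueryAlgorithm E α q) (f : E → α) : T.acceptProb f ∈ Set.Icc (0 : ℝ) 1 := by
  refine ⟨Finset.sum_nonneg fun S _ => mul_nonneg ENNReal.toReal_nonneg (T.decision S _).2.1, ?_⟩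
  exact (Finset.sum_le_sum fun S _ =>
    mul_le_of_le_one_right ENNReal.toReal_nonneg (T.decision S _).2.2).trans
      (sum_toReal_pmf T.queries).le

/-- The sample size of the canonical test built from a tolerant test of a resilient property. -/
noncomputable def canonicalSize (δ η : ℝ → ℝ) (q : ℝ → ℕ) (ε : ℝ) : ℕ :=
  2 * (216 * q (ε / 2)) * (2 * ⌈160 / min (δ (ε / 2)) (δ (η (ε / 2)))⌉₊) ^ 2

/-- Resilience enters twice: with parameter `η (ε / 2)` it keeps a rearranged member in the
accepting range of the tolerant test, and with parameter `ε / 2` it keeps a rearranged `ε`-far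
structure `ε / 2`-far. Hence the minimum of two values of `δ`. -/
theorem canonicallyTestableWith_canonicalSize [DecidableEq α] {P : Property K α} {δ η : ℝ → ℝ}
    {q : ℝ → ℕ} (hδ : ∀ ε ∈ Set.Ioo (0 : ℝ) 1, δ ε ∈ Set.Ioo (0 : ℝ) 1)
    (hη : ∀ ε ∈ Set.Ioo (0 : ℝ) 1, 0 < η ε ∧ η ε < ε) (hres : ResilientWith P δ)
    (htol : TolerantlyTestableWith P η q) :
    CanonicallyTestableWith P (canonicalSize δ η q) := by
  classical
  intro ε hε n
  have hε2 : ε / 2 ∈ Set.Ioo (0 : ℝ) 1 := ⟨by linarith [hε.1], by linarith [hε.2]⟩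
  have hηε : η (ε / 2) ∈ Set.Ioo (0 : ℝ) 1 :=
    ⟨(hη _ hε2).1, (hη _ hε2).2.trans hε2.2⟩
  set δ₀ := min (δ (ε / 2)) (δ (η (ε / 2))) with hδ₀
  have hδ₀0 : 0 < δ₀ := lt_min (hδ _ hε2).1 (hδ _ hηε).1
  obtain ⟨cl, hcl, hbad⟩ := exists_classes_of_le K n hδ₀0 (Nat.le_ceil (160 / δ₀))
  obtain ⟨T, hT1, hT2⟩ := htol _ hε2 n
  -- As `216 / 6 ^ 2 = 6`, the error drops to `1/6`, leaving room for the probability `1/20` of a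
  -- bad rearrangement below `1/3`.
  obtain ⟨T₁, hT₁⟩ := T.exists_amplification (r := 216) (by norm_num) (t := 1 / 6)
    (by norm_num) (1 / 2)
  obtain ⟨T₂, hT₂⟩ := exists_canonicalAlgorithm_of_classPerm cl hcl
    (Q := canonicalSize δ η q ε) le_rfl T₁
  set B : (Axis K → Equiv.Perm (Fin n)) → ℝ := fun σ =>
    if ((∑ x, displacement (classPerm cl (σ x)) : ℕ) : ℝ) ≤ δ₀ * ((numBase K n).choose 2 : ℕ)
    then (0 : ℝ) else 1 with hB
  refine ⟨T₂, fun f hf => ?_, fun f hf => ?_⟩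
  · have h1 : ∀ σ : Axis K → Equiv.Perm (Fin n), 5 / 6 - B σ ≤
        T₁.acceptProb fun e => f (permute (fun x => classPerm cl (σ x)) e) := by
      intro σ
      simp only [hB]
      split_ifs with h
      · have h2 := hres _ hηε n f _ hf (earthmover_permute_le f
          (fun x => classPerm cl (σ x)) (hδ _ hηε).1.le (h.trans (by
            gcongr
            exact min_le_right _ _)))
        have h3 := (hT₁ _).1 (le_trans (by norm_num) (hT1 _ h2))
        norm_num at h3 ⊢
        exact h3
      · exact le_trans (by norm_num) (T₁.acceptProb_mem_Icc _).1
    have h2 := Finset.expect_le_expect (s := Finset.univ) fun σ _ => h1 σ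
    rw [Finset.expect_sub_distrib, Fintype.expect_const, ← hT₂ f] at h2
    linarith
  · have h1 : ∀ σ : Axis K → Equiv.Perm (Fin n),
        T₁.acceptProb (fun e => f (permute (fun x => classPerm cl (σ x)) e)) ≤ 1 / 6 + B σ := by
      intro σ
      simp only [hB]
      split_ifs with h
      · have h2 : ¬ CloseTo (P n) (ε / 2)
            (fun e => f (permute (fun x => classPerm cl (σ x)) e)) := by
          intro hclose
          have := closeTo_of_closeTo_permute hres hε2 f (fun x => classPerm cl (σ x))
            (hδ _ hε2).1.le (h.trans (by
              gcongr
              exact min_le_left _ _)) hclose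
          rw [add_halves] at this
          exact hf this
        have h3 := hT2 _ h2
        have h4 := (hT₁ fun e => f (permute (fun x => classPerm cl (σ x)) e)).2 (by linarith)
        norm_num at h4 ⊢
        exact h4
      · exact (T₁.acceptProb_mem_Icc _).2.trans (by norm_num)
    have h2 := Finset.expect_le_expect (s := Finset.univ) fun σ _ => h1 σ
    rw [Finset.expect_add_distrib, Fintype.expect_const, ← hT₂ f] at h2
    linarith

lemma polyBounded_canonicalSize {δ η : ℝ → ℝ} {q : ℝ → ℕ}
    (hδ : ∀ ε ∈ Set.Ioo (0 : ℝ) 1, δ ε ∈ Set.Ioo (0 : ℝ) 1)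
    (hη : ∀ ε ∈ Set.Ioo (0 : ℝ) 1, 0 < η ε ∧ η ε < ε)
    (hqp : PolyBounded fun ε => (q ε : ℝ)) (hηp : PolyBounded fun ε => 1 / η ε)
    (hδp : PolyBounded fun ε => 1 / δ ε) :
    PolyBounded fun ε => (canonicalSize δ η q ε : ℝ) := by
  have h2 : ∀ ε ∈ Set.Ioo (0 : ℝ) 1, ε / 2 ∈ Set.Ioo (0 : ℝ) 1 :=
    fun ε hε => ⟨by linarith [hε.1], by linarith [hε.2]⟩
  have hη2 : ∀ ε ∈ Set.Ioo (0 : ℝ) 1, η (ε / 2) ∈ Set.Ioo (0 : ℝ) 1 :=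
    fun ε hε => ⟨(hη _ (h2 ε hε)).1, (hη _ (h2 ε hε)).2.trans (h2 ε hε).2⟩
  have hδ1 : PolyBounded fun ε => 1 / δ (ε / 2) := hδp.comp h2 polyBounded_one_div_half
  have hδ2 : PolyBounded fun ε => 1 / δ (η (ε / 2)) :=
    hδp.comp hη2 (hηp.comp h2 polyBounded_one_div_half)
  have hq2 : PolyBounded fun ε => (q (ε / 2) : ℝ) := hqp.comp h2 polyBounded_one_div_half
  have hmin0 : ∀ ε ∈ Set.Ioo (0 : ℝ) 1, 0 < min (δ (ε / 2)) (δ (η (ε / 2))) :=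
    fun ε hε => lt_min (hδ _ (h2 ε hε)).1 (hδ _ (hη2 ε hε)).1
  have hmin := polyBounded_one_div_min (fun ε hε => (hδ _ (h2 ε hε)).1)
    (fun ε hε => (hδ _ (hη2 ε hε)).1) hδ1 hδ2
  have hceil : PolyBounded fun ε => (⌈160 / min (δ (ε / 2)) (δ (η (ε / 2)))⌉₊ : ℝ) := by
    refine (((polyBounded_const 160).mul hmin fun ε hε => (one_div_pos.2 (hmin0 ε hε)).le).add
      (polyBounded_const 1)).of_le fun ε hε => ?_
    rw [mul_one_div]
    exact (Nat.ceil_lt_add_one (div_pos (by norm_num) (hmin0 ε hε)).le).le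
  refine (((polyBounded_const 1728).mul hq2 fun ε _ => Nat.cast_nonneg _).mul
    (hceil.mul hceil fun ε _ => Nat.cast_nonneg _) fun ε _ => mul_self_nonneg _).of_le
      fun ε _ => ?_
  simp only [canonicalSize]
  push_cast
  exact le_of_eq (by ring)

end ToCanonical

end OrdKind

/-! ### The equivalence and its quantitative forms -/

theorem mainTheorem1 (K : OrdKind) {α : Type*} [Fintype α] [DecidableEq α]
    (P : OrdKind.Property K α) :
    -- the qualitative equivalence
    ((OrdKind.Resilient P ∧ OrdKind.TolerantlyTestable P) ↔ OrdKind.CanonicallyTestable P) ∧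
    -- from resilience and tolerant tests to canonical tests
    (∀ (δ η : ℝ → ℝ) (q : ℝ → ℕ),
      (∀ ε ∈ Set.Ioo (0 : ℝ) 1, δ ε ∈ Set.Ioo (0 : ℝ) 1) →
      (∀ ε ∈ Set.Ioo (0 : ℝ) 1, 0 < η ε ∧ η ε < ε) →
      OrdKind.ResilientWith P δ → OrdKind.TolerantlyTestableWith P η q →
      OrdKind.CanonicallyTestable P ∧
      (OrdKind.PolyBounded (fun ε => (q ε : ℝ)) → OrdKind.PolyBounded (fun ε => 1 / η ε) →
        OrdKind.PolyBounded (fun ε => 1 / δ ε) →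
        ∃ q' : ℝ → ℕ, OrdKind.CanonicallyTestableWith P q' ∧
          OrdKind.PolyBounded (fun ε => (q' ε : ℝ)))) ∧
    -- from canonical tests to resilience and tolerant tests
    (∀ q' : ℝ → ℕ, OrdKind.CanonicallyTestableWith P q' →
      OrdKind.ResilientWith P (OrdKind.canonicalDelta q') ∧
      (∃ q : ℝ → ℕ, OrdKind.TolerantlyTestableWith P (OrdKind.canonicalDelta q') q) ∧
      (∃ q : ℝ → ℕ, OrdKind.TolerantlyTestableWith P
        (fun ε => min (OrdKind.canonicalDelta q' ε) (ε / 2)) q) ∧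
      (∀ ε ∈ Set.Ioo (0 : ℝ) 1, OrdKind.canonicalDelta q' ε ∈ Set.Ioo (0 : ℝ) 1) ∧
      (OrdKind.PolyBounded (fun ε => (q' ε : ℝ)) →
        OrdKind.PolyBounded (fun ε => 1 / OrdKind.canonicalDelta q' ε) ∧
        OrdKind.PolyBounded (fun ε => 1 / min (OrdKind.canonicalDelta q' ε) (ε / 2)))) := by
  have hto := fun (δ η : ℝ → ℝ) (q : ℝ → ℕ) hδ hη hres htol =>
    OrdKind.canonicallyTestableWith_canonicalSize (P := P) (δ := δ) (η := η) (q := q)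
      hδ hη hres htol
  have hmin : ∀ q' : ℝ → ℕ, OrdKind.CanonicallyTestableWith P q' →
      ∃ q : ℝ → ℕ, OrdKind.TolerantlyTestableWith P
        (fun ε => min (OrdKind.canonicalDelta q' ε) (ε / 2)) q := fun q' h =>
    ⟨_, (OrdKind.tolerantlyTestableWith_canonicalDelta h).mono fun _ => min_le_left _ _⟩
  have hmem : ∀ (q' : ℝ → ℕ), ∀ ε ∈ Set.Ioo (0 : ℝ) 1,
      OrdKind.canonicalDelta q' ε ∈ Set.Ioo (0 : ℝ) 1 := fun q' ε _ =>
    ⟨OrdKind.canonicalDelta_pos q' ε, OrdKind.canonicalDelta_lt_one q' ε⟩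
  refine ⟨⟨?_, ?_⟩, fun δ η q hδ hη hres htol => ⟨⟨_, hto δ η q hδ hη hres htol⟩, fun hq hηp hδp =>
    ⟨_, hto δ η q hδ hη hres htol, OrdKind.polyBounded_canonicalSize hδ hη hq hηp hδp⟩⟩,
    fun q' h => ⟨OrdKind.resilientWith_canonicalDelta h,
      ⟨_, OrdKind.tolerantlyTestableWith_canonicalDelta h⟩, hmin q' h, hmem q', fun hq =>
      ⟨OrdKind.polyBounded_one_div_canonicalDelta hq, OrdKind.polyBounded_one_div_min
        (fun ε hε => (hmem q' ε hε).1) (fun ε hε => half_pos hε.1)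
        (OrdKind.polyBounded_one_div_canonicalDelta hq) OrdKind.polyBounded_one_div_half⟩⟩⟩
  · rintro ⟨⟨δ, hδ, hres⟩, η, q, hη, htol⟩
    exact ⟨_, hto δ η q hδ hη hres htol⟩
  · rintro ⟨q', h⟩
    obtain ⟨q, hq⟩ := hmin q' h
    -- The minimum with `ε / 2` is taken because tolerant testability asks for `η ε < ε`, which
    -- `canonicalDelta` need not satisfy.
    refine ⟨⟨_, hmem q', OrdKind.resilientWith_canonicalDelta h⟩, _, q, fun ε hε => ?_, hq⟩
    exact ⟨lt_min (hmem q' ε hε).1 (half_pos hε.1),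
      (min_le_right _ _).trans_lt (half_lt_self hε.1)⟩
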